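/- Setting. Let $n,j\ge 1$, $\rho_n=\sum_{i=1}^{2n+1}(-1)^{n+i-1}e_{i,2n+2-i}$, $\langle X,Y\rangle=X^t\rho_nY$, $A^\sharp=\rho_nA^t\rho_n$, $o(n+1,n)=\{A\in gl(2n+1,\mathbb R): A^t\rho_n+\rho_nA=0\}$, and let $\mathcal B_n^+$ be its subalgebra of upper triangular matrices. Put $b=\sum_{i=1}^{2n}e_{i+1,i}$, $\beta=\frac12(e_{1,2n}+e_{2,2n+1})$, $J_B(\lambda)=\beta\lambda+b$. For smooth $q:\mathbb R\to\mathcal B_n^+$ let $T(q,\lambda)=\beta\lambda+\sum_{i\le 0}T_{1,i}(q)\lambda^i$ be the (unique) formal series with coefficients in $o(n+1,n)$ such that $[\partial_x+J_B(\lambda)+q,\,T]=0$ and $T^{2n+1}=\lambda T$; write $T_{2j-1,i}(q)$ for the coefficient of $\lambda^i$ in $T(q,\lambda)^{2j-1}$ and $(\cdot)_+$ for the part of a series with non-negative powers of $\lambda$. A smooth $q:\mathbb R^2\to\mathcal B_n^+$ is a solution of the $(2j-1)$-th $\hat B_n^{(1)}$-flow if $q_t=[\partial_x+b+q,\,T_{2j-1,0}(q)]$.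 A frame of $q$ is a map $F(x,t,\lambda)\in SL(2n+1,\mathbb C)$, holomorphic in $\lambda\in\mathbb C$, with $F^t\rho_nF=\rho_n$, $\overline{F(x,t,\bar\lambda)}=F(x,t,\lambda)$, $F^{-1}F_x=J_B(\lambda)+q$ and $F^{-1}F_t=(T(q,\lambda)^{2j-1})_+$. Let $f$ be a rational map $\mathbb C\cup\{\infty\}\to GL(2n+1,\mathbb C)$ with $f(\infty)=I$, $f(\lambda)^t\rho_nf(\lambda)=\rho_n$ and $\overline{f(\bar\lambda)}=f(\lambda)$ (a rational loop), let $q$ be a solution of the $(2j-1)$-th flow, and $F$ its frame with $F(0,0,\lambda)=I$. Then $f\bullet q$ is defined at those points $(x,t)$ at which there is a factorization $f(\lambda)F(x,t,\lambda)=\tilde F(\lambda)\tilde f(\lambda)$ with $\tilde f$ a rational loop and $\tilde F:\mathbb C\to GL(2n+1,\mathbb C)$ holomorphic satisfying $\tilde F^t\rho_n\tilde F=\rho_n$ and $\overline{\tilde F(\bar\lambda)}=\tilde F(\lambda)$; there $(f\bullet q)(x,t)=q(x,t)+[\tilde f_{-1},\beta]$, where $\tilde f_{-1}$ is the coefficient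 of $\lambda^{-1}$ in the expansion of $\tilde f$ at $\lambda=\infty$. For real $\alpha_1,\alpha_2$ and a projection $\pi$ of $\mathbb R^{2n+1}$ with $\pi\pi^\sharp=\pi^\sharp\pi=0$ put $$g_{\alpha_1,\alpha_2,\pi}(\lambda)=I+\frac{\alpha_2-\alpha_1}{\lambda-\alpha_2}\pi+\frac{\alpha_1-\alpha_2}{\lambda-\alpha_1}\pi^\sharp .$$ For $r\in\mathbb R\setminus\{0\}$ put $\Gamma(r)=\mathrm{diag}(1,r,\dots,r^{2n})$ and $(r\odot q)(x,t)=r\,\Gamma(r)^{-1}q(rx,r^{2j-1}t)\,\Gamma(r)$. Theorem. Let $q$ be a solution of the $(2j-1)$-th $\hat B_n^{(1)}$-flow on $\mathbb R^2$ with frame $F$ such that $F(0,0,\lambda)=I$. Let $r\in\mathbb R\setminus\{0\}$, $\alpha\in\mathbb R$, and let $\pi$ be the rank one projection of $\mathbb R^{2n+1}$ onto $V_1$ along $V_2$, with $\pi\pi^\sharp=\pi^\sharp\pi=0$. Put $\hat\pi=\Gamma(r)\pi\Gamma(r)^{-1}$. Then $\hat\pi$ is the rank one projection onto $\Gamma(r)V_1$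 along $\Gamma(r)V_2$, it satisfies $\hat\pi\hat\pi^\sharp=\hat\pi^\sharp\hat\pi=0$, and $$g_{r^{-2n},\,r^{-2n}\alpha,\,\hat\pi}\bullet q=r^{-1}\odot\bigl(g_{1,\alpha,\pi}\bullet(r\odot q)\bigr),$$ in the sense that the left side is defined at $(x,t)$ if and only if $g_{1,\alpha,\pi}\bullet(r\odot q)$ is defined at $(r^{-1}x,r^{-(2j-1)}t)$, both are defined at $(0,0)$, and the two sides agree wherever they are defined. -/

import Mathlib

open Filter Topology

open scoped ContDiff

noncomputable section

namespace BnFlow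

/-- Square matrices of size `2n+1`; rows and columns are numbered `0, …, 2n`. -/
abbrev Mat (n : ℕ) (K : Type*) : Type _ := Matrix (Fin (2 * n + 1)) (Fin (2 * n + 1)) K

/-! ### The form, the Lie algebra and the Lax operator -/

/-- The matrix `ρ_n` of the bilinear form `⟨X, Y⟩ = Xᵗ ρ_n Y`: in one-based numbering it is
`∑ i, (-1)^(n+i-1) e_{i, 2n+2-i}`. -/
def rho (n : ℕ) (K : Type*) [Ring K] : Mat n K :=
  Matrix.of fun i k => if (i : ℕ) + (k : ℕ) = 2 * n then (-1) ^ (n + (i : ℕ)) else 0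

/-- `β = (e_{1,2n} + e_{2,2n+1}) / 2` in one-based numbering (for `n ≥ 1`). -/
def beta (n : ℕ) (K : Type*) [Field K] : Mat n K :=
  Matrix.of fun i k =>
    if ((i : ℕ) = 0 ∧ (k : ℕ) + 1 = 2 * n) ∨ ((i : ℕ) = 1 ∧ (k : ℕ) = 2 * n) then 1 / 2 else 0

/-- `b = ∑ e_{i+1,i}`. -/
def bMat (n : ℕ) (K : Type*) [Field K] : Mat n K :=
  Matrix.of fun i k => if (i : ℕ) = (k : ℕ) + 1 then 1 else 0

/-- `J_B(λ) = β λ + b`, for `λ` a number or a formal variable. -/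
def JB (n : ℕ) {K : Type*} [Field K] (lam : K) : Mat n K :=
  lam • beta n K + bMat n K

/-- The subalgebra of upper triangular matrices of `o(n+1,n)`. -/
def IsBorel (n : ℕ) (A : Mat n ℝ) : Prop :=
  A.transpose * rho n ℝ + rho n ℝ * A = 0 ∧
    ∀ i k : Fin (2 * n + 1), k < i → A i k = 0

/-- `Γ(r) = diag(1, r, …, r^{2n})`. -/
def Gam (n : ℕ) (r : ℝ) : Mat n ℝ :=
  Matrix.diagonal fun i => r ^ (i : ℕ)

/-! ### The flows

Formal series `∑_{i ≤ N} A_i λ^i` are Laurent series in the variable `λ⁻¹`: the coefficient of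
`λ^i` is `coeff (-i)`. -/

/-- The formal variable `λ`. -/
def lamVar : LaurentSeries ℝ := HahnSeries.single (-1 : ℤ) (1 : ℝ)

/-- The coefficient of `λ^i` in a matrix of series. -/
def lamCoeff {n : ℕ} (A : Mat n (LaurentSeries ℝ)) (i : ℤ) : Mat n ℝ :=
  A.map fun s => s.coeff (-i)

/-- `T` is the series `T(q, λ) = β λ + ∑_{i ≤ 0} T_{1,i}(q) λ^i` attached to `q = q(x)`: it has
values in `o(n+1,n)`, it satisfies `[∂_x + J_B(λ) + q, T] = 0` and `T^{2n+1} = λ T`. These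
conditions determine `T` uniquely. -/
structure IsResolvent (n : ℕ) (q : ℝ → Mat n ℝ) (T : ℝ → Mat n (LaurentSeries ℝ)) : Prop where
  degree_le : ∀ x, ∀ i : ℤ, 1 < i → lamCoeff (T x) i = 0
  leading : ∀ x, lamCoeff (T x) 1 = beta n ℝ
  skew : ∀ x, (T x).transpose * rho n (LaurentSeries ℝ) + rho n (LaurentSeries ℝ) * T x = 0
  lax : ∀ x, ∀ i : ℤ, ∀ a c, HasDerivAt (fun y => lamCoeff (T y) i a c)
    (lamCoeff (T x * (JB n lamVar + (q x).map HahnSeries.C)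
      - (JB n lamVar + (q x).map HahnSeries.C) * T x) i a c) x
  power : ∀ x, T x ^ (2 * n + 1) = lamVar • T x

/-- `q` is a smooth solution, on all of `ℝ²`, of the `(2j-1)`-th flow
`q_t = [∂_x + b + q, T_{2j-1,0}(q)]`, where `T_{2j-1,0}(q)` is the coefficient of `λ^0` in
`T(q, λ)^{2j-1}`. -/
structure IsFlowSolution (n j : ℕ) (q : ℝ → ℝ → Mat n ℝ) : Prop where
  smooth : ∀ a c, ContDiff ℝ ∞ (fun p : ℝ × ℝ => q p.1 p.2 a c)
  borel : ∀ x t, IsBorel n (q x t)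
  flow : ∃ T : ℝ → ℝ → Mat n (LaurentSeries ℝ),
    (∀ t, IsResolvent n (fun x => q x t) (fun x => T x t)) ∧
    ∀ x t a c, HasDerivAt (fun s => q x s a c)
      (deriv (fun y => lamCoeff (T y t ^ (2 * j - 1)) 0 a c) x
        + ((bMat n ℝ + q x t) * lamCoeff (T x t ^ (2 * j - 1)) 0
          - lamCoeff (T x t ^ (2 * j - 1)) 0 * (bMat n ℝ + q x t)) a c) t

/-- A real matrix regarded as a complex one. -/
def toC {n : ℕ} (A : Mat n ℝ) : Mat n ℂ := A.map fun s => (s : ℂ)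

/-- The value at `λ = z` of the part `∑_{0 ≤ i < N} A_i λ^i` of a series. -/
def polyPart {n : ℕ} (N : ℕ) (A : Mat n (LaurentSeries ℝ)) (z : ℂ) : Mat n ℂ :=
  ∑ i ∈ Finset.range N, z ^ i • toC (lamCoeff A (i : ℤ))

/-- The entire loops: holomorphic `f : ℂ → GL(2n+1, ℂ)` with `f(λ)ᵗ ρ_n f(λ) = ρ_n` and
`conj (f (conj λ)) = f λ`. -/
structure IsEntireLoop (n : ℕ) (f : ℂ → Mat n ℂ) : Prop where
  holo : ∀ a c, Differentiable ℂ (fun z => f z a c)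
  orth : ∀ z, (f z).transpose * rho n ℂ * f z = rho n ℂ
  real : ∀ z, (f (star z)).map star = f z

/-- `F(x, t, λ)` is a frame of `q` for the `(2j-1)`-th flow: `F_x = F (J_B(λ) + q)`,
`F_t = F (T(q, λ)^{2j-1})_+`, with `F(x, t, ·)` an entire loop in `O_ℂ(n+1,n)`. The series
`T^{2j-1}` has degree at most `2j-1` in `λ`, so its part `(·)_+` has terms of degree `< 2j`. -/
structure IsFrame (n j : ℕ) (q : ℝ → ℝ → Mat n ℝ) (F : ℝ → ℝ → ℂ → Mat n ℂ) : Prop where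
  entire : ∀ x t, IsEntireLoop n (F x t)
  det_eq_one : ∀ x t z, (F x t z).det = 1
  deriv_x : ∀ x t z a c, HasDerivAt (fun y : ℝ => F y t z a c)
    ((F x t z * (JB n z + toC (q x t))) a c) x
  deriv_t : ∃ T : ℝ → ℝ → Mat n (LaurentSeries ℝ),
    (∀ t, IsResolvent n (fun x => q x t) (fun x => T x t)) ∧
    ∀ x t z a c, HasDerivAt (fun s : ℝ => F x s z a c)
      ((F x t z * polyPart (2 * j) (T x t ^ (2 * j - 1)) z) a c) t

/-! ### Rational loops and their action -/

/-- The rational loops: rational maps `f : ℂ ∪ {∞} → GL(2n+1, ℂ)` with `f(∞) = I`,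
`f(λ)ᵗ ρ_n f(λ) = ρ_n` and `conj (f (conj λ)) = f λ`. The values of `f` at the finitely many poles
are irrelevant. -/
structure IsRationalLoop (n : ℕ) (f : ℂ → Mat n ℂ) : Prop where
  rational : ∃ (d : Polynomial ℂ) (N : Mat n (Polynomial ℂ)), d ≠ 0 ∧
    ∀ z, d.eval z ≠ 0 → f z = (d.eval z)⁻¹ • N.map (Polynomial.eval z)
  at_infinity : Tendsto f (Bornology.cobounded ℂ) (𝓝 1)
  orth : ∀ᶠ z in cofinite, (f z).transpose * rho n ℂ * f z = rho n ℂ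
  real : ∀ᶠ z in cofinite, (f (star z)).map star = f z

/-- `v` is the value at `(x, t)` of `f • q`: with `F` the frame of the solution `q` such that
`F(0, 0, λ) = I`, there is a factorization `f(λ) F(x,t,λ) = F'(λ) f'(λ)` into an entire loop `F'`
and a rational loop `f'`, and `v = q(x,t) + [A, β]` where `A` is the coefficient of `λ⁻¹` in the
expansion of `f'` at `λ = ∞`. -/
def IsDressedValue (n j : ℕ) (f : ℂ → Mat n ℂ) (q : ℝ → ℝ → Mat n ℝ) (x t : ℝ) (v : Mat n ℝ) :
    Prop :=
  IsRationalLoop n f ∧ IsFlowSolution n j q ∧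
    ∃ F : ℝ → ℝ → ℂ → Mat n ℂ, IsFrame n j q F ∧ (∀ z, F 0 0 z = 1) ∧
      ∃ (F' f' : ℂ → Mat n ℂ) (A : Mat n ℝ), IsEntireLoop n F' ∧ IsRationalLoop n f' ∧
        (∀ᶠ z in cofinite, f z * F x t z = F' z * f' z) ∧
        Tendsto (fun z => z • (f' z - 1)) (Bornology.cobounded ℂ) (𝓝 (toC A)) ∧
        v = q x t + (A * beta n ℝ - beta n ℝ * A)

/-- The set of points of `ℝ²` at which `f • q` is defined, i.e. at which the factorization
exists. -/
def dressDomain (n j : ℕ) (f : ℂ → Mat n ℂ) (q : ℝ → ℝ → Mat n ℝ) : Set (ℝ × ℝ) :=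
  {p | ∃ v, IsDressedValue n j f q p.1 p.2 v}

open Classical in
/-- The function `f • q` (with value `0` at the points where it is not defined). -/
def dress (n j : ℕ) (f : ℂ → Mat n ℂ) (q : ℝ → ℝ → Mat n ℝ) : ℝ → ℝ → Mat n ℝ :=
  fun x t => if h : ∃ v, IsDressedValue n j f q x t v then h.choose else 0

/-- The adjoint `A^♯ = ρ_n Aᵗ ρ_n` with respect to the bilinear form. -/
def sharp {n : ℕ} (A : Mat n ℝ) : Mat n ℝ := rho n ℝ * A.transpose * rho n ℝ

/-- `P` is the projection of `ℝ^{n+1,n}` onto `V₁` along `V₂`. -/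
def IsProjectionOnto {n : ℕ} (P : Mat n ℝ) (V₁ V₂ : Submodule ℝ (Fin (2 * n + 1) → ℝ)) : Prop :=
  P * P = P ∧ LinearMap.range (Matrix.toLin' P) = V₁ ∧ LinearMap.ker (Matrix.toLin' P) = V₂

/-- The condition `P P^♯ = P^♯ P = 0`. -/
def IsIsotropic {n : ℕ} (P : Mat n ℝ) : Prop := P * sharp P = 0 ∧ sharp P * P = 0

/-- The simple element
`g_{α₁,α₂,P}(λ) = I + (α₂-α₁)/(λ-α₂) P + (α₁-α₂)/(λ-α₁) P^♯`. -/
def simpleLoop {n : ℕ} (α₁ α₂ : ℝ) (P : Mat n ℝ) : ℂ → Mat n ℂ := fun z =>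
  1 + (((α₂ : ℂ) - α₁) / (z - α₂)) • toC P + (((α₁ : ℂ) - α₂) / (z - α₁)) • toC (sharp P)

/-- The scaling transform `(r ⊙ q)(x, t) = r Γ(r)⁻¹ q(r x, r^{2j-1} t) Γ(r)` for the `(2j-1)`-th
flow. -/
def scale (n j : ℕ) (r : ℝ) (q : ℝ → ℝ → Mat n ℝ) : ℝ → ℝ → Mat n ℝ := fun x t =>
  r • ((Gam n r)⁻¹ * q (r * x) (r ^ (2 * j - 1) * t) * Gam n r)

end BnFlow

end

noncomputable section

namespace BnFlow

/-! The theorem is a covariance statement. The twist `M(λ) ↦ Γ(r)⁻¹ M(r^{-2n} λ) Γ(r)` is an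
invertible homomorphism that preserves the form, the reality condition, entire loops and rational
loops, and it satisfies `r Γ(r)⁻¹ J_B(r^{-2n} λ) Γ(r) = J_B(λ)` (`smul_gconj_JB`). Hence it carries
`T(q, λ)`, up to a factor `r`, to `T(r ⊙ q, λ)`, solutions to solutions, frames to frames and
factorizations to factorizations. So `f • q` turns into (twist of `f`) `•` (`r ⊙ q`)
(`IsDressedValue.scale`). The twist of the simple element with poles `r^{-2n}, r^{-2n} α` and
projection `Γ(r) P Γ(r)⁻¹` is the one with poles `1, α` and projection `P` (`conjLoop_simpleLoop`).

Since `dress` picks a value by choice, equality of functions needs uniqueness of the value. This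
rests on three facts: factorizations are unique by Liouville (`factorization_unique`), normalized
frames are unique because both solve the same linear equations (`IsFrame.unique`), and the series
`T` in those equations is unique (`IsResolvent.unique`). The last is the algebraic core.
Substituting `λ = μ^{2n}` and conjugating by `Γ(μ)` makes `J_B` homogeneous of degree 1 in `μ`; then
the leading coefficient of any solution of the Lax equation commutes with `J_B(1)`, and `T^{2n+1} =
λ T` forces the difference of two solutions to vanish. -/

/-! ### Conjugation by `Γ(s)` over a general field (used over `ℝ`, `ℂ` and Laurent series). -/

lemma units_pow_mul_inv_pow {K : Type*} [Field K] (s : Kˣ) (k : ℕ) :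
    (s : K) ^ k * (↑s⁻¹ : K) ^ k = 1 := by
  rw [← mul_pow, Units.mul_inv, one_pow]

lemma units_pow_sub {K : Type*} [Field K] (s : Kˣ) {k l : ℕ} (h : l ≤ k) :
    (s : K) ^ (k - l) = (↑s⁻¹ : K) ^ l * (s : K) ^ k := by
  obtain ⟨m, rfl⟩ := Nat.exists_eq_add_of_le h
  rw [Nat.add_sub_cancel_left, pow_add]
  linear_combination -(s : K) ^ m * units_pow_mul_inv_pow s l

/-- Conjugation `M ↦ Γ(s)⁻¹ M Γ(s)`, with `Γ(s) = diag(1, s, …, s^{2n})`. -/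
def gconj (n : ℕ) {K : Type*} [Field K] (s : Kˣ) : Mat n K →ₐ[K] Mat n K where
  toFun M := Matrix.of fun a c => (↑s⁻¹ : K) ^ (a : ℕ) * M a c * (s : K) ^ (c : ℕ)
  map_one' := by
    ext a c
    by_cases h : a = c
    · subst h; simp
    · simp [h]
  map_mul' A B := by
    ext a c
    simp only [Matrix.of_apply, Matrix.mul_apply, Finset.mul_sum, Finset.sum_mul]
    refine Finset.sum_congr rfl fun l _ => ?_
    have h : (s : K) ^ (l : ℕ) * (↑s⁻¹ : K) ^ (l : ℕ) = 1 :=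
      units_pow_mul_inv_pow s l
    linear_combination (-(↑s⁻¹ : K) ^ (a : ℕ) * A a l * B l c * (s : K) ^ (c : ℕ)) * h
  map_zero' := by ext; simp
  map_add' A B := by ext; simp; ring
  commutes' k := by
    ext a c
    by_cases h : a = c
    · subst h
      have h : (s : K) ^ (a : ℕ) * (↑s⁻¹ : K) ^ (a : ℕ) = 1 := units_pow_mul_inv_pow s _
      simp only [Algebra.algebraMap_eq_smul_one, Matrix.of_apply, Matrix.smul_apply,
        Matrix.one_apply_eq, smul_eq_mul]
      linear_combination k * h
    · simp [h, Algebra.algebraMap_eq_smul_one]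

section
variable {n : ℕ} {K : Type*} [Field K]

lemma gconj_apply (s : Kˣ) (M : Mat n K) (a c : Fin (2 * n + 1)) :
    gconj n s M a c = (↑s⁻¹ : K) ^ (a : ℕ) * M a c * (s : K) ^ (c : ℕ) := rfl

lemma gconj_inv_gconj (s : Kˣ) (M : Mat n K) : gconj n s⁻¹ (gconj n s M) = M := by
  ext a c
  have h1 : (s : K) ^ (a : ℕ) * (↑s⁻¹ : K) ^ (a : ℕ) = 1 := units_pow_mul_inv_pow s _
  have h2 : (s : K) ^ (c : ℕ) * (↑s⁻¹ : K) ^ (c : ℕ) = 1 := units_pow_mul_inv_pow s _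
  simp only [gconj_apply, inv_inv]
  linear_combination M a c * h1 * ((s : K) ^ (c : ℕ) * (↑s⁻¹ : K) ^ (c : ℕ)) + M a c * h2

lemma gconj_gconj_inv (s : Kˣ) (M : Mat n K) : gconj n s (gconj n s⁻¹ M) = M := by
  simpa using gconj_inv_gconj s⁻¹ M

lemma gconj_map {L : Type*} [Field L] (φ : K →+* L) (s : Kˣ) (M : Mat n K) :
    (gconj n s M).map φ = gconj n (Units.map (φ : K →* L) s) (M.map φ) := by
  ext a c
  simp [gconj_apply]

/-- Conjugation multiplies entry `(a, c)` by `s^{c-a}`, and both entries of `β` have `c - a = 2n -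
1`. For `b` the exponent is `-1`, hence the invariance that follows. -/
lemma smul_gconj_beta (s : Kˣ) :
    (s : K) • gconj n s (beta n K) = (s : K) ^ (2 * n) • beta n K := by
  ext a c
  simp only [beta, Matrix.smul_apply, gconj_apply, Matrix.of_apply, smul_eq_mul]
  split_ifs with h
  · rcases h with ⟨ha, hc⟩ | ⟨ha, hc⟩
    · rw [ha, show (s : K) ^ (2 * n) = (s : K) ^ ((c : ℕ) + 1) by rw [hc]]; ring
    · rw [ha, hc]
      have : (s : K) * (↑s⁻¹ : K) = 1 := by simp
      linear_combination (s : K) ^ (2 * n) * (1 / 2) * this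
  · simp

lemma smul_gconj_bMat (s : Kˣ) : (s : K) • gconj n s (bMat n K) = bMat n K := by
  ext a c
  simp only [bMat, Matrix.smul_apply, gconj_apply, Matrix.of_apply, smul_eq_mul]
  split_ifs with h
  · rw [h, pow_succ]
    have h1 : (s : K) * (↑s⁻¹ : K) = 1 := by simp
    have h2 : (s : K) ^ (c : ℕ) * (↑s⁻¹ : K) ^ (c : ℕ) = 1 := units_pow_mul_inv_pow s _
    linear_combination h1 * ((s : K) ^ (c : ℕ) * (↑s⁻¹ : K) ^ (c : ℕ)) + h2
  · simp

lemma smul_gconj_JB (s : Kˣ) (z : K) :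
    (s : K) • gconj n s (JB n z) = JB n ((s : K) ^ (2 * n) * z) := by
  rw [JB, JB, map_add, map_smul, smul_add, smul_gconj_bMat, smul_comm, smul_gconj_beta, smul_smul,
    mul_comm z]

lemma rho_mul_apply (M : Mat n K) (a c : Fin (2 * n + 1)) :
    (rho n K * M) a c = (-1) ^ (n + (a : ℕ)) * M a.rev c := by
  rw [Matrix.mul_apply, Finset.sum_eq_single a.rev]
  · rw [rho, Matrix.of_apply, if_pos]; rw [Fin.val_rev]; omega
  · intro l _ hl
    rw [rho, Matrix.of_apply, if_neg, zero_mul]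
    intro h; apply hl; ext; rw [Fin.val_rev]; omega
  · simp

lemma rho_transpose : (rho n K).transpose = rho n K := by
  ext a c
  simp only [rho, Matrix.transpose_apply, Matrix.of_apply, add_comm (c : ℕ) (a : ℕ)]
  split_ifs with h
  · rcases neg_one_pow_eq_or K (n + (a : ℕ)) with h1 | h1
    all_goals
      have : (-1 : K) ^ (n + (c : ℕ)) * (-1) ^ (n + (a : ℕ)) = 1 := by
        rw [← pow_add, show n + (c : ℕ) + (n + a) = 2 * (2 * n) by omega, pow_mul]; simp
      rw [h1] at this ⊢
      first | linear_combination this | linear_combination -this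
  · rfl

lemma mul_rho_apply (M : Mat n K) (a c : Fin (2 * n + 1)) :
    (M * rho n K) a c = (-1) ^ (n + (c : ℕ)) * M a c.rev := by
  have := rho_mul_apply M.transpose c a
  rw [← rho_transpose, ← Matrix.transpose_mul, Matrix.transpose_apply,
    Matrix.transpose_apply] at this
  exact this

lemma rho_mul_rho : rho n K * rho n K = 1 := by
  ext a c
  rw [rho_mul_apply, rho, Matrix.of_apply, Matrix.one_apply, Fin.val_rev]
  by_cases h : a = c
  · subst h
    rw [if_pos (by omega), if_pos rfl, ← pow_add,
      show n + (a : ℕ) + (n + (2 * n + 1 - (a + 1))) = 2 * (2 * n) by omega, pow_mul]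
    simp
  · rw [if_neg h, if_neg, mul_zero]
    intro h'; apply h; ext; omega

/-- `ρ Γ(s) ρ = s^{2n} Γ(s)⁻¹`: the matrix `Γ(s)` preserves the form only up to a scalar, and the
scalar cancels in a conjugation. -/
lemma gconj_rho_transpose_rho (s : Kˣ) (M : Mat n K) :
    gconj n s (rho n K * M.transpose * rho n K) =
      rho n K * (gconj n s M).transpose * rho n K := by
  ext a c
  simp only [gconj_apply, mul_rho_apply, rho_mul_apply, Matrix.transpose_apply, Fin.val_rev]
  have e1 : (s : K) ^ (2 * n + 1 - ((a : ℕ) + 1)) = (↑s⁻¹ : K) ^ (a : ℕ) * (s : K) ^ (2 * n) := by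
    rw [Nat.add_sub_add_right, units_pow_sub s (by omega)]
  have e2 : (↑s⁻¹ : K) ^ (2 * n + 1 - ((c : ℕ) + 1)) =
      (s : K) ^ (c : ℕ) * (↑s⁻¹ : K) ^ (2 * n) := by
    rw [Nat.add_sub_add_right, units_pow_sub s⁻¹ (by omega), inv_inv]
  have h3 : (s : K) ^ (2 * n) * (↑s⁻¹ : K) ^ (2 * n) = 1 := units_pow_mul_inv_pow s _
  rw [e1, e2]
  linear_combination -((-1) ^ (n + (c : ℕ)) * (-1) ^ (n + (a : ℕ)) * M c.rev a.rev *
    (s : K) ^ (c : ℕ) * (↑s⁻¹ : K) ^ (a : ℕ)) * h3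

lemma skew_iff (M : Mat n K) :
    M.transpose * rho n K + rho n K * M = 0 ↔ rho n K * M.transpose * rho n K = -M := by
  constructor
  · intro h
    have := congrArg (rho n K * ·) h
    simp only [mul_add, ← mul_assoc, rho_mul_rho, one_mul, mul_zero] at this
    exact eq_neg_of_add_eq_zero_left this
  · intro h
    have := congrArg (rho n K * ·) h
    simp only [← mul_assoc, rho_mul_rho, one_mul] at this
    rw [this]; simp

lemma skew_gconj (s : Kˣ) {M : Mat n K} (h : M.transpose * rho n K + rho n K * M = 0) :
    (gconj n s M).transpose * rho n K + rho n K * gconj n s M = 0 := by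
  rw [skew_iff] at h ⊢
  rw [← gconj_rho_transpose_rho, h, map_neg]

lemma orth_iff (M : Mat n K) :
    M.transpose * rho n K * M = rho n K ↔ rho n K * M.transpose * rho n K * M = 1 := by
  constructor
  · intro h
    rw [mul_assoc, mul_assoc, ← mul_assoc M.transpose, h, rho_mul_rho]
  · intro h
    have := congrArg (rho n K * ·) h
    simpa only [← mul_assoc, rho_mul_rho, one_mul, mul_one] using this

lemma orth_gconj (s : Kˣ) {M : Mat n K} (h : M.transpose * rho n K * M = rho n K) :
    (gconj n s M).transpose * rho n K * gconj n s M = rho n K := by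
  rw [orth_iff] at h ⊢
  rw [← gconj_rho_transpose_rho, ← map_mul, h, map_one]

lemma det_gconj (s : Kˣ) (M : Mat n K) : (gconj n s M).det = M.det := by
  have : gconj n s M = Matrix.diagonal (fun a : Fin (2 * n + 1) => (↑s⁻¹ : K) ^ (a : ℕ)) * M *
      Matrix.diagonal (fun a : Fin (2 * n + 1) => (s : K) ^ (a : ℕ)) := by
    ext a c
    simp [gconj_apply]
  rw [this, Matrix.det_mul, Matrix.det_mul, mul_right_comm, ← Matrix.det_mul,
    Matrix.diagonal_mul_diagonal]
  simp

end

/-! ### `Γ(r)` over the reals: the scaling transform and conjugated projections. -/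

section
variable {n : ℕ}

lemma Gam_inv_mul_mul_Gam (r : ℝˣ) (M : Mat n ℝ) :
    (Gam n r)⁻¹ * M * Gam n r = gconj n r M := by
  have h : (Gam n (r : ℝ))⁻¹ = Matrix.diagonal fun i : Fin (2 * n + 1) => (↑r⁻¹ : ℝ) ^ (i : ℕ) := by
    refine Matrix.inv_eq_right_inv ?_
    rw [Gam, Matrix.diagonal_mul_diagonal]
    simp
  ext a c
  rw [h, Gam]
  simp [gconj_apply]

lemma Gam_mul_inv (r : ℝˣ) : Gam n r * (Gam n r)⁻¹ = 1 := by
  refine Matrix.mul_nonsing_inv _ ?_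
  rw [Gam, Matrix.det_diagonal]
  exact (Finset.prod_ne_zero_iff.2 fun i _ => pow_ne_zero _ r.ne_zero).isUnit

lemma Gam_inv_mul (r : ℝˣ) : (Gam n r)⁻¹ * Gam n r = 1 :=
  mul_eq_one_comm.1 (Gam_mul_inv r)

lemma Gam_mul_mul_inv (r : ℝˣ) (M : Mat n ℝ) :
    Gam n r * M * (Gam n r)⁻¹ = gconj n r⁻¹ M := by
  have h := Gam_inv_mul_mul_Gam r (gconj n r⁻¹ M)
  rw [gconj_gconj_inv] at h
  calc _ = Gam n r * ((Gam n r)⁻¹ * gconj n r⁻¹ M * Gam n r) * (Gam n r)⁻¹ := by rw [h]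
    _ = (Gam n r * (Gam n r)⁻¹) * gconj n r⁻¹ M * (Gam n r * (Gam n r)⁻¹) := by
        simp only [mul_assoc]
    _ = _ := by rw [Gam_mul_inv]; simp

lemma scale_apply (j : ℕ) (r : ℝˣ) (q : ℝ → ℝ → Mat n ℝ) (x t : ℝ) :
    scale n j r q x t = (r : ℝ) • gconj n r (q (r * x) (r ^ (2 * j - 1) * t)) := by
  rw [scale, Gam_inv_mul_mul_Gam]

lemma scale_inv_scale (j : ℕ) (r : ℝˣ) (q : ℝ → ℝ → Mat n ℝ) :
    scale n j (↑r⁻¹ : ℝ) (scale n j r q) = q := by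
  funext x t
  simp only [scale_apply, map_smul, gconj_inv_gconj, smul_smul, ← mul_assoc, ← mul_pow]
  simp

lemma sharp_gconj (r : ℝˣ) (P : Mat n ℝ) : sharp (gconj n r P) = gconj n r (sharp P) :=
  (gconj_rho_transpose_rho r P).symm

lemma isIsotropic_gconj (r : ℝˣ) {P : Mat n ℝ} (h : IsIsotropic P) :
    IsIsotropic (gconj n r P) := by
  rw [IsIsotropic, sharp_gconj, ← map_mul, ← map_mul, h.1, h.2]
  simp

lemma toC_gconj (r : ℝˣ) (M : Mat n ℝ) :
    toC (gconj n r M) = gconj n (Units.map (Complex.ofRealHom : ℝ →* ℂ) r) (toC M) :=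
  gconj_map Complex.ofRealHom r M

lemma isProjectionOnto_Gam_conj (r : ℝˣ) {P : Mat n ℝ}
    {V₁ V₂ : Submodule ℝ (Fin (2 * n + 1) → ℝ)} (h : IsProjectionOnto P V₁ V₂) :
    IsProjectionOnto (Gam n r * P * (Gam n r)⁻¹) (V₁.map (Matrix.toLin' (Gam n r)))
      (V₂.map (Matrix.toLin' (Gam n r))) := by
  obtain ⟨h1, h2, h3⟩ := h
  have hl : ∀ v, (Gam n r).mulVec ((Gam n r)⁻¹.mulVec v) = v := fun v => by
    rw [Matrix.mulVec_mulVec, Gam_mul_inv, Matrix.one_mulVec]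
  have hr : ∀ v, (Gam n r)⁻¹.mulVec ((Gam n r).mulVec v) = v := fun v => by
    rw [Matrix.mulVec_mulVec, Gam_inv_mul, Matrix.one_mulVec]
  refine ⟨?_, ?_, ?_⟩
  · rw [Gam_mul_mul_inv, ← map_mul, h1]
  · ext v
    simp only [← h2, LinearMap.mem_range, Submodule.mem_map, Matrix.toLin'_apply,
      ← Matrix.mulVec_mulVec, exists_exists_eq_and]
    exact ⟨fun ⟨y, hy⟩ => ⟨_, hy⟩, fun ⟨y, hy⟩ => ⟨(Gam n r).mulVec y, by rw [hr, hy]⟩⟩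
  · ext v
    simp only [← h3, LinearMap.mem_ker, Submodule.mem_map, Matrix.toLin'_apply,
      ← Matrix.mulVec_mulVec]
    constructor
    · intro h
      refine ⟨(Gam n r)⁻¹.mulVec v, ?_, hl v⟩
      rw [← hr (P.mulVec _), h, Matrix.mulVec_zero]
    · rintro ⟨y, hy, rfl⟩
      rw [hr, hy, Matrix.mulVec_zero]

lemma rank_Gam_conj (r : ℝˣ) (P : Mat n ℝ) :
    (Gam n r * P * (Gam n r)⁻¹).rank = P.rank := by
  have hdet : IsUnit (Gam n r).det := (Matrix.isUnit_iff_isUnit_det _).1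
    ⟨⟨_, _, Gam_mul_inv r, Gam_inv_mul r⟩, rfl⟩
  rw [Matrix.rank_mul_eq_left_of_isUnit_det _ _ (Matrix.isUnit_nonsing_inv_det _ hdet),
    Matrix.rank_mul_eq_right_of_isUnit_det _ _ hdet]

end

/-! ### Degrees of matrix series and the principal grading. -/

section
variable {n : ℕ}

lemma lamCoeff_add (A B : Mat n (LaurentSeries ℝ)) (i : ℤ) :
    lamCoeff (A + B) i = lamCoeff A i + lamCoeff B i := by
  ext; simp [lamCoeff]

lemma lamCoeff_sub (A B : Mat n (LaurentSeries ℝ)) (i : ℤ) :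
    lamCoeff (A - B) i = lamCoeff A i - lamCoeff B i := by
  ext; simp [lamCoeff]

lemma coeff_mul_top {a b : LaurentSeries ℝ} {d e : ℤ} (ha : ∀ i < d, a.coeff i = 0)
    (hb : ∀ i < e, b.coeff i = 0) :
    (∀ i < d + e, (a * b).coeff i = 0) ∧ (a * b).coeff (d + e) = a.coeff d * b.coeff e := by
  constructor
  · intro i hi
    rw [HahnSeries.coeff_mul]
    refine Finset.sum_eq_zero fun p hp => ?_
    rw [Finset.mem_antidiagonal] at hp
    by_cases h : p.1 < d
    · rw [ha _ h, zero_mul]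
    · rw [hb _ (by omega), mul_zero]
  · rw [HahnSeries.coeff_mul]
    refine Finset.sum_eq_single (d, e) (fun p hp hne => ?_) fun h => ?_
    · rw [Finset.mem_antidiagonal] at hp
      by_cases h : p.1 < d
      · rw [ha _ h, zero_mul]
      · by_cases h' : p.2 < e
        · rw [hb _ h', mul_zero]
        · exact absurd (Prod.ext (by omega) (by omega)) hne
    · simp only [Finset.mem_antidiagonal, HahnSeries.mem_support, and_true, not_and_or,
        not_not] at h
      exact mul_eq_zero.2 h

/-- The matrix of series `A` has degree at most `d`, with coefficient `C` at `λ^d`. -/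
def HasTop (A : Mat n (LaurentSeries ℝ)) (d : ℤ) (C : Mat n ℝ) : Prop :=
  (∀ i, d < i → lamCoeff A i = 0) ∧ lamCoeff A d = C

lemma HasTop.mul {A B : Mat n (LaurentSeries ℝ)} {d e : ℤ} {C D : Mat n ℝ} (hA : HasTop A d C)
    (hB : HasTop B e D) : HasTop (A * B) (d + e) (C * D) := by
  have key : ∀ a l c, (∀ i < -d + -e, (A a l * B l c).coeff i = 0) ∧
      (A a l * B l c).coeff (-d + -e) = C a l * D l c := by
    intro a l c
    rw [← hA.2, ← hB.2]
    refine coeff_mul_top (fun i hi => ?_) (fun i hi => ?_)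
    · simpa [lamCoeff] using congrFun₂ (hA.1 (-i) (by omega)) a l
    · simpa [lamCoeff] using congrFun₂ (hB.1 (-i) (by omega)) l c
  constructor
  · intro i hi
    ext a c
    simp only [lamCoeff, Matrix.map_apply, Matrix.mul_apply, HahnSeries.coeff_sum,
      Matrix.zero_apply]
    exact Finset.sum_eq_zero fun l _ => (key a l c).1 _ (by omega)
  · ext a c
    simp only [lamCoeff, Matrix.map_apply, Matrix.mul_apply, HahnSeries.coeff_sum]
    exact Finset.sum_congr rfl fun l _ => by rw [neg_add, (key a l c).2]

lemma HasTop.add {A B : Mat n (LaurentSeries ℝ)} {d : ℤ} {C D : Mat n ℝ} (hA : HasTop A d C)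
    (hB : HasTop B d D) : HasTop (A + B) d (C + D) :=
  ⟨fun i hi => by rw [lamCoeff_add, hA.1 i hi, hB.1 i hi, add_zero],
    by rw [lamCoeff_add, hA.2, hB.2]⟩

lemma hasTop_one : HasTop (1 : Mat n (LaurentSeries ℝ)) 0 1 := by
  have key : ∀ i : ℤ, lamCoeff (1 : Mat n (LaurentSeries ℝ)) i = if i = 0 then 1 else 0 := by
    intro i
    ext a c
    by_cases h : a = c
    · subst h
      by_cases hi : i = 0 <;> simp [lamCoeff, HahnSeries.coeff_one, hi]
    · by_cases hi : i = 0 <;> simp [lamCoeff, hi, h]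
  exact ⟨fun i hi => by rw [key, if_neg hi.ne'], by rw [key, if_pos rfl]⟩

lemma HasTop.pow {A : Mat n (LaurentSeries ℝ)} {d : ℤ} {C : Mat n ℝ} (hA : HasTop A d C)
    (k : ℕ) : HasTop (A ^ k) (k * d) (C ^ k) := by
  induction k with
  | zero => simpa using hasTop_one
  | succ k ih =>
    rw [pow_succ, pow_succ, show ((k + 1 : ℕ) : ℤ) * d = k * d + d by push_cast; ring]
    exact ih.mul hA

/-- Induction through `A^{k+2} - B^{k+2} = A^{k+1}(A - B) + (A^{k+1} - B^{k+1})B`; commutation of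
`D` with `C` makes the leading terms add up instead of cancelling. -/
lemma HasTop.pow_sub_pow {A B : Mat n (LaurentSeries ℝ)} {m : ℤ} {C D : Mat n ℝ}
    (hA : HasTop A 1 C) (hB : HasTop B 1 C) (hD : HasTop (A - B) m D) (hc : Commute D C) (k : ℕ) :
    HasTop (A ^ (k + 1) - B ^ (k + 1)) (k + m) (((k + 1 : ℕ) : ℝ) • (C ^ k * D)) := by
  induction k with
  | zero => simpa using hD
  | succ k ih =>
    have h1 := (hA.pow (k + 1)).mul hD
    have h2 := ih.mul hB
    rw [show (k : ℤ) + m + 1 = (k + 1 : ℕ) + m by push_cast; ring] at h2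
    rw [mul_one] at h1
    have h3 := h1.add h2
    rw [show A ^ (k + 1) * (A - B) + (A ^ (k + 1) - B ^ (k + 1)) * B
      = A ^ (k + 1 + 1) - B ^ (k + 1 + 1) by
      rw [pow_succ A (k + 1), pow_succ B (k + 1), mul_sub, sub_mul]; abel] at h3
    convert h3 using 1
    rw [smul_mul_assoc, mul_assoc, hc.eq, ← mul_assoc, ← pow_succ]
    push_cast
    module

/-- The variable of Laurent series in its inverse, as a unit. -/
def lamUnit : (LaurentSeries ℝ)ˣ where
  val := lamVar
  inv := HahnSeries.single (1 : ℤ) (1 : ℝ)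
  val_inv := by simp [lamVar, HahnSeries.single_mul_single]
  inv_val := by simp [lamVar, HahnSeries.single_mul_single]

lemma lamUnit_pow (k : ℕ) :
    (lamUnit : LaurentSeries ℝ) ^ k = HahnSeries.single (-(k : ℤ)) (1 : ℝ) := by
  simp [lamUnit, lamVar, HahnSeries.single_pow]

lemma lamUnit_inv_pow (k : ℕ) :
    (↑lamUnit⁻¹ : LaurentSeries ℝ) ^ k = HahnSeries.single (k : ℤ) (1 : ℝ) := by
  change (HahnSeries.single (1 : ℤ) (1 : ℝ)) ^ k = _
  simp [HahnSeries.single_pow]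

/-- The substitution `λ = μ^N` in Laurent series. -/
def expand (N : ℕ) (hN : 0 < N) : LaurentSeries ℝ →+* LaurentSeries ℝ :=
  HahnSeries.embDomainRingHom (AddMonoidHom.mulLeft (N : ℤ))
    (fun a b h => by simpa [hN.ne'] using h) (fun a b => by simp [hN])

lemma expand_coeff_mul (N : ℕ) (hN : 0 < N) (s : LaurentSeries ℝ) (k : ℤ) :
    (expand N hN s).coeff (N * k) = s.coeff k :=
  HahnSeries.embDomain_coeff (f := ⟨⟨AddMonoidHom.mulLeft (N : ℤ), _⟩, _⟩) (a := k)

lemma expand_coeff_of_not_dvd (N : ℕ) (hN : 0 < N) (s : LaurentSeries ℝ) {k : ℤ}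
    (hk : ¬ (N : ℤ) ∣ k) : (expand N hN s).coeff k = 0 :=
  HahnSeries.embDomain_of_notMem_range (by rintro ⟨l, rfl⟩; exact hk ⟨l, rfl⟩)

lemma expand_lamVar (N : ℕ) (hN : 0 < N) : expand N hN lamVar = (lamUnit : LaurentSeries ℝ) ^ N := by
  rw [lamUnit_pow]
  refine HahnSeries.embDomain_single.trans ?_
  simp

/-- The passage `T ↦ Γ(μ) T(μ^{2n}) Γ(μ)⁻¹` to the principal grading. -/
def principal (n : ℕ) (hn : 0 < 2 * n) :
    Mat n (LaurentSeries ℝ) →+* Mat n (LaurentSeries ℝ) :=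
  (gconj n lamUnit⁻¹).toRingHom.comp (expand (2 * n) hn).mapMatrix

lemma principal_eq (hn : 0 < 2 * n) (T : Mat n (LaurentSeries ℝ)) :
    principal n hn T = gconj n lamUnit⁻¹ (T.map (expand (2 * n) hn)) := rfl

lemma principal_injective (hn : 0 < 2 * n) : Function.Injective (principal n hn) := by
  intro A B h
  rw [principal_eq, principal_eq] at h
  have := congrArg (gconj n lamUnit⁻¹⁻¹) h
  rw [gconj_inv_gconj, gconj_inv_gconj] at this
  exact Matrix.map_injective (expand (2 * n) hn).injective this

lemma principal_smul_lamVar (hn : 0 < 2 * n) (T : Mat n (LaurentSeries ℝ)) :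
    principal n hn (lamVar • T) = lamVar ^ (2 * n) • principal n hn T := by
  rw [principal_eq, principal_eq, Matrix.map_smul' _ _ _ (map_mul _), map_smul, expand_lamVar]
  rfl

/-- Entry `(a, c)` of the coefficient of `λ^p` lands in degree `2n p + a - c` in `μ`. -/
lemma lamCoeff_principal (hn : 0 < 2 * n) (T : Mat n (LaurentSeries ℝ)) {m : ℤ}
    {a c : Fin (2 * n + 1)} {p : ℤ} (h : m + c - a = (2 * n : ℕ) * p) :
    lamCoeff (principal n hn T) m a c = lamCoeff T p a c := by
  simp only [principal_eq, lamCoeff, Matrix.map_apply, gconj_apply, inv_inv, lamUnit_pow,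
    lamUnit_inv_pow]
  rw [HahnSeries.coeff_mul_single, mul_one, HahnSeries.coeff_single_mul, one_mul,
    show -m - (c : ℤ) - -(a : ℤ) = (2 * n : ℕ) * -p by rw [mul_neg, ← h]; ring, expand_coeff_mul]

lemma lamCoeff_principal_of_not_dvd (hn : 0 < 2 * n) (T : Mat n (LaurentSeries ℝ)) {m : ℤ}
    {a c : Fin (2 * n + 1)} (h : ¬ ((2 * n : ℕ) : ℤ) ∣ m + c - a) :
    lamCoeff (principal n hn T) m a c = 0 := by
  simp only [principal_eq, lamCoeff, Matrix.map_apply, gconj_apply, inv_inv, lamUnit_pow,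
    lamUnit_inv_pow]
  rw [HahnSeries.coeff_mul_single, mul_one, HahnSeries.coeff_single_mul, one_mul,
    expand_coeff_of_not_dvd]
  rwa [← dvd_neg, show -(-m - (c : ℤ) - -(a : ℤ)) = m + c - a by ring]

lemma map_JB {K L : Type*} [Field K] [Field L] (φ : K →+* L) (z : K) :
    (JB n z).map φ = JB n (φ z) := by
  ext a c
  simp only [JB, beta, bMat, Matrix.map_apply, Matrix.add_apply, Matrix.smul_apply,
    Matrix.of_apply, smul_eq_mul, map_add, map_mul]
  congr 1
  · congr 1
    split_ifs
    · rw [map_div₀, map_one, map_ofNat]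
    · exact map_zero φ
  · split_ifs <;> simp

/-- On the right `lamVar` plays the role of `μ`: in the principal grading the Lax matrix is
homogeneous of degree 1. -/
lemma principal_JB (hn : 0 < 2 * n) :
    principal n hn (JB n lamVar) = lamVar • (JB n (1 : ℝ)).map HahnSeries.C := by
  rw [principal_eq, map_JB, expand_lamVar]
  have h := smul_gconj_JB (n := n) lamUnit⁻¹ ((lamUnit : LaurentSeries ℝ) ^ (2 * n))
  rw [mul_comm (_ ^ _) (_ ^ _), units_pow_mul_inv_pow] at h
  rw [map_JB, map_one, ← h, smul_smul]
  change _ = ((lamUnit : LaurentSeries ℝ) * ↑lamUnit⁻¹) • _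
  rw [Units.mul_inv, one_smul]

lemma hasTop_smul_C (M : Mat n ℝ) : HasTop (lamVar • M.map HahnSeries.C) 1 M := by
  have key : ∀ i : ℤ, lamCoeff (lamVar • M.map HahnSeries.C) i = if i = 1 then M else 0 := by
    intro i
    ext a c
    simp only [lamCoeff, lamVar, Matrix.map_apply, Matrix.smul_apply, smul_eq_mul,
      HahnSeries.coeff_single_mul, one_mul, HahnSeries.C_apply, HahnSeries.coeff_single]
    by_cases h : i = 1
    · simp [h]
    · simp only [h, if_false, Matrix.zero_apply]
      rw [if_neg (by omega)]
  exact ⟨fun i hi => by rw [key, if_neg hi.ne'], by rw [key, if_pos rfl]⟩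

lemma lamCoeff_map_C (M : Mat n ℝ) (i : ℤ) :
    lamCoeff (M.map HahnSeries.C) i = if i = 0 then M else 0 := by
  ext a c
  by_cases h : i = 0 <;> simp [lamCoeff, h]

/-- Entry `(a, c)` of the constant term `q` gets degree `a - c`, which is at most 0 on the upper
triangle, so `q` does not affect the leading term. -/
lemma hasTop_principal_lax (hn : 0 < 2 * n) {q : Mat n ℝ}
    (hq : ∀ i k : Fin (2 * n + 1), k < i → q i k = 0) :
    HasTop (principal n hn (JB n lamVar + q.map HahnSeries.C)) 1 (JB n 1) := by
  have h : ∀ i : ℤ, 0 < i → lamCoeff (principal n hn (q.map HahnSeries.C)) i = 0 := by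
    intro i hi
    ext a c
    by_cases hd : ((2 * n : ℕ) : ℤ) ∣ i + c - a
    · obtain ⟨p, hp⟩ := hd
      rw [lamCoeff_principal hn _ hp, lamCoeff_map_C]
      split_ifs with h0
      · subst h0
        rw [hq _ _ (by rw [Fin.lt_def]; omega), Matrix.zero_apply]
      · rfl
    · rw [lamCoeff_principal_of_not_dvd hn _ hd, Matrix.zero_apply]
  rw [map_add, principal_JB]
  simpa using (hasTop_smul_C _).add (B := principal n hn (q.map HahnSeries.C)) (D := 0)
    ⟨fun i hi => h i (by omega), h 1 one_pos⟩

end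

/-! ### Uniqueness of the series `T(q, λ)`. -/

section
variable {n : ℕ}

lemma bMat_apply_of_ne {K : Type*} [Field K] {a c : Fin (2 * n + 1)} (h : (a : ℕ) ≠ c + 1) :
    bMat n K a c = 0 := by
  simp [bMat, h]

lemma JB_one_apply (a c : Fin (2 * n + 1)) :
    JB n (1 : ℝ) a c = beta n ℝ a c + bMat n ℝ a c := by
  simp [JB]

/-- The first basis vector is cyclic for `J_B(1)`, so a commuting matrix is determined by its first
column. -/
lemma eq_zero_of_commute_JB {X : Mat n ℝ} (hX : Commute X (JB n 1)) (h0 : ∀ a, X a 0 = 0) :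
    X = 0 := by
  have key : ∀ i (hi : i < 2 * n + 1), ∀ a, X a ⟨i, hi⟩ = 0 := by
    intro i
    induction i with
    | zero => exact fun _ a => h0 a
    | succ i ih =>
      intro hi a
      have hi' : i < 2 * n + 1 := by omega
      have h := congrFun₂ hX.eq a ⟨i, hi'⟩
      rw [Matrix.mul_apply, Matrix.mul_apply,
        Finset.sum_eq_zero (s := Finset.univ) (f := fun l => JB n 1 a l * X l ⟨i, hi'⟩)
          fun l _ => by rw [ih hi' l, mul_zero],
        Finset.sum_eq_single ⟨i + 1, hi⟩] at h
      · rw [JB_one_apply] at h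
        simpa [bMat, beta, show ¬ (i = 0 ∧ i + 1 = 2 * n ∧ False) by tauto,
          show i ≠ 2 * n by omega] using h
      · intro l _ hl
        by_cases hl0 : l = 0
        · rw [hl0, h0, zero_mul]
        · have h1 : (l : ℕ) ≠ i + 1 := fun h' => hl (Fin.ext h')
          have h2 : (l : ℕ) ≠ 0 := fun h' => hl0 (Fin.ext h')
          rw [JB_one_apply, bMat_apply_of_ne h1]
          have hb : beta n ℝ l ⟨i, hi'⟩ = 0 := by
            rw [beta, Matrix.of_apply, if_neg (by simp only; omega)]
          rw [hb, add_zero, mul_zero]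
      · simp
  ext a c
  exact key c c.2 a

/-- Only the entry `(N, 0)` of the first column can survive; the entries of `β` in the last two
columns of `J_B(1)` rule it out. -/
lemma eq_zero_of_commute_JB_of_support (hn : 0 < 2 * n) {X : Mat n ℝ} (hX : Commute X (JB n 1))
    {N : ℕ} (hN : 1 ≤ N) (hs : ∀ a c : Fin (2 * n + 1), (a : ℕ) ≠ c + N → X a c = 0) : X = 0 := by
  refine eq_zero_of_commute_JB hX fun a => ?_
  by_cases haN : (a : ℕ) = N
  swap
  · exact hs a 0 (by simpa using haN)
  rcases Nat.lt_or_ge 1 N with hN1 | hN1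
  -- For `N ≥ 2` column `2n - 1` of `X` is zero, while `X J_B(1)` has there half of column 0 of `X`.
  · have h := congrFun₂ hX.eq a ⟨2 * n - 1, by omega⟩
    rw [Matrix.mul_apply, Matrix.mul_apply, Finset.sum_eq_single 0,
      Finset.sum_eq_zero (s := Finset.univ)] at h
    · rw [JB_one_apply, bMat_apply_of_ne (by simp)] at h
      simpa [beta, show 2 * n - 1 + 1 = 2 * n by omega] using h
    · intro l _
      rw [hs l _ (by have := l.2; change (l : ℕ) ≠ 2 * n - 1 + N; omega), mul_zero]
    · intro l _ hl
      by_cases h' : (a : ℕ) = l + N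
      · exact absurd (Fin.ext (by rw [Fin.val_zero]; omega)) hl
      · rw [hs _ _ h', zero_mul]
    · simp
  -- For `N = 1`, entry `(2, 0)` of the commutation relation gives `X₂₁ = X₁₀`, and entry `(2, 2n)`
  -- gives `X₂₁ / 2 = 0`.
  · obtain rfl : N = 1 := le_antisymm hN1 hN
    let e1 : Fin (2 * n + 1) := ⟨1, by omega⟩
    let e2 : Fin (2 * n + 1) := ⟨2, by omega⟩
    let el : Fin (2 * n + 1) := ⟨2 * n, by omega⟩
    have hae : a = e1 := Fin.ext haN
    have hb10 : JB n (1 : ℝ) e1 0 = 1 := by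
      rw [JB_one_apply]
      simp [beta, bMat, e1, hn.ne]
    have hb21 : JB n (1 : ℝ) e2 e1 = 1 := by
      rw [JB_one_apply]
      simp [beta, bMat, e1, e2]
    have hb1l : JB n (1 : ℝ) e1 el = 1 / 2 := by
      rw [JB_one_apply]
      simp [beta, bMat, e1, el, hn.ne']
    have hrow : ∀ c, (X * JB n (1 : ℝ) : Mat n ℝ) e2 c = X e2 e1 * JB n (1 : ℝ) e1 c := by
      intro c
      rw [Matrix.mul_apply, Finset.sum_eq_single e1]
      · intro l _ hl
        rw [hs, zero_mul]
        intro h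
        exact hl (Fin.ext (by simp [e1, e2] at h ⊢; omega))
      · simp
    have h0 := congrFun₂ hX.eq e2 0
    have hl := congrFun₂ hX.eq e2 el
    rw [hrow, Matrix.mul_apply, Finset.sum_eq_single e1, hb10, hb21] at h0
    · rw [hrow, hb1l, Matrix.mul_apply, Finset.sum_eq_zero] at hl
      · rw [hae]; linarith
      · intro l _
        rw [hs l el (by have := l.2; simp only [el]; omega), mul_zero]
    · intro l _ hl
      rw [hs l 0 (fun h => hl (Fin.ext (by simpa [e1] using h))), mul_zero]
    · simp

variable {q : ℝ → Mat n ℝ} {T T' : ℝ → Mat n (LaurentSeries ℝ)}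

/-- In degree `i ≥ 1` the exponent `p` with `2n p = i + c - a` is nonnegative, and `p = 0` means `a
= c + i`. Off that subdiagonal `p ≥ 1`, where only the known leading term `β` contributes, and it
has degree 1. -/
lemma IsResolvent.lamCoeff_principal_support (hn : 0 < 2 * n) (hT : IsResolvent n q T) (x : ℝ)
    {i : ℤ} (hi : 1 ≤ i) {a c : Fin (2 * n + 1)} (h : (a : ℤ) ≠ c + i) :
    lamCoeff (principal n hn (T x)) i a c = if i = 1 then beta n ℝ a c else 0 := by
  have ha := a.2
  have hc := c.2
  have hbeta : beta n ℝ a c ≠ 0 → (c : ℤ) + 1 - a = (2 * n : ℕ) := by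
    intro h
    by_contra h'
    refine h ?_
    rw [beta, Matrix.of_apply, if_neg]
    omega
  by_cases hd : ((2 * n : ℕ) : ℤ) ∣ i + c - a
  · obtain ⟨p, hp⟩ := hd
    rw [lamCoeff_principal hn _ hp]
    have hp0 : p ≠ 0 := by rintro rfl; rw [mul_zero] at hp; omega
    have hp1 : 0 < p := by
      by_contra hneg
      have : ((2 * n : ℕ) : ℤ) * p ≤ (2 * n : ℕ) * (-1) :=
        mul_le_mul_of_nonneg_left (by omega) (by omega)
      omega
    rcases eq_or_lt_of_le (show 1 ≤ p by omega) with rfl | hp2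
    · rw [hT.leading]
      split_ifs with h1
      · rfl
      · by_contra hne
        have := hbeta hne
        omega
    · rw [hT.degree_le x p hp2]
      split_ifs with h1
      · by_contra hne
        have := hbeta (Ne.symm hne)
        have : ((2 * n : ℕ) : ℤ) * 2 ≤ (2 * n : ℕ) * p :=
          mul_le_mul_of_nonneg_left (by omega) (by omega)
        omega
      · rfl
  · rw [lamCoeff_principal_of_not_dvd hn _ hd]
    split_ifs with h1
    · by_contra hne
      have := hbeta (Ne.symm hne)
      exact hd ⟨1, by omega⟩
    · rfl

lemma IsResolvent.lamCoeff_principal_eq_zero (hn : 0 < 2 * n) (hT : IsResolvent n q T) (x : ℝ)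
    {i : ℤ} (hi : ((2 * n : ℕ) : ℤ) < i) : lamCoeff (principal n hn (T x)) i = 0 := by
  ext a c
  have ha := a.2
  rw [hT.lamCoeff_principal_support hn x (by omega) (by omega), if_neg (by omega),
    Matrix.zero_apply]

lemma hasDerivAt_lamCoeff_principal (hn : 0 < 2 * n) {A B : ℝ → Mat n (LaurentSeries ℝ)} {x : ℝ}
    (h : ∀ i a c, HasDerivAt (fun y => lamCoeff (A y) i a c) (lamCoeff (B x) i a c) x) (i : ℤ)
    (a c : Fin (2 * n + 1)) :
    HasDerivAt (fun y => lamCoeff (principal n hn (A y)) i a c)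
      (lamCoeff (principal n hn (B x)) i a c) x := by
  by_cases hd : ((2 * n : ℕ) : ℤ) ∣ i + c - a
  · obtain ⟨p, hp⟩ := hd
    simpa only [lamCoeff_principal hn _ hp] using h p a c
  · simpa only [lamCoeff_principal_of_not_dvd hn _ hd] using hasDerivAt_const x (0 : ℝ)

/-- In degree `m + 1` the `x`-derivative vanishes while the commutator is that of the leading terms.
Only the linear Lax equation is assumed, so the lemma also applies to differences of resolvents. -/
lemma commute_JB_of_lax (hn : 0 < 2 * n)
    (hq : ∀ x, ∀ i k : Fin (2 * n + 1), k < i → q x i k = 0)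
    (hT : ∀ x i a c, HasDerivAt (fun y => lamCoeff (T y) i a c)
      (lamCoeff (T x * (JB n lamVar + (q x).map HahnSeries.C)
        - (JB n lamVar + (q x).map HahnSeries.C) * T x) i a c) x)
    {m : ℤ} (hm : ∀ x i, m < i → lamCoeff (principal n hn (T x)) i = 0) (x : ℝ) :
    Commute (lamCoeff (principal n hn (T x)) m) (JB n 1) := by
  have hL := hasTop_principal_lax hn (hq x)
  have hS : HasTop (principal n hn (T x)) m (lamCoeff (principal n hn (T x)) m) := ⟨hm x, rfl⟩
  have h1 := (hS.mul hL).2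
  have h2 := (hL.mul hS).2
  refine sub_eq_zero.1 ?_
  rw [← h1, ← h2, add_comm 1 m, ← lamCoeff_sub, ← map_mul, ← map_mul, ← map_sub]
  ext a c
  have h3 := hasDerivAt_lamCoeff_principal hn (A := T)
    (B := fun x => T x * (JB n lamVar + (q x).map HahnSeries.C)
        - (JB n lamVar + (q x).map HahnSeries.C) * T x) (hT x) (m + 1) a c
  simp only [hm _ (m + 1) (by omega)] at h3
  exact h3.unique (hasDerivAt_const x _)

/-- A priori the degree in `μ` may reach `2n`. Descending from there, each leading coefficient in
degree `i > 1` lies on one subdiagonal and commutes with `J_B(1)`, hence is zero. -/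
lemma IsResolvent.hasTop_principal (hn : 0 < 2 * n)
    (hq : ∀ x, ∀ i k : Fin (2 * n + 1), k < i → q x i k = 0) (hT : IsResolvent n q T) (x : ℝ) :
    HasTop (principal n hn (T x)) 1 (JB n 1) := by
  have key : ∀ k : ℕ, ∀ x, ∀ i : ℤ, (2 * n : ℕ) - (k : ℤ) < i → 1 < i →
      lamCoeff (principal n hn (T x)) i = 0 := by
    intro k
    induction k with
    | zero => exact fun x i hi _ => hT.lamCoeff_principal_eq_zero hn x (by simpa using hi)
    | succ k ih =>
      intro x i hi hi1
      rcases lt_or_ge ((2 * n : ℕ) - (k : ℤ)) i with hk | hk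
      · exact ih x i hk hi1
      have hc := commute_JB_of_lax hn hq (fun x i => hT.lax x i) (m := i)
        (fun x l hl => ih x l (by omega) (by omega)) x
      refine eq_zero_of_commute_JB_of_support hn hc (N := i.toNat) (by omega) fun a c hac => ?_
      rw [hT.lamCoeff_principal_support hn x (by omega) (by omega), if_neg (by omega)]
  have h2 : ∀ x, ∀ i : ℤ, 1 < i → lamCoeff (principal n hn (T x)) i = 0 :=
    fun x i hi => key (2 * n) x i (by omega) hi
  refine ⟨h2 x, sub_eq_zero.1 ?_⟩
  -- In degree 1 the part off the first subdiagonal is already `β`, so the difference with `J_B(1)`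
  -- is again a commuting matrix on one subdiagonal.
  have hc := (commute_JB_of_lax hn hq (fun x i => hT.lax x i) h2 x).sub_left
    (Commute.refl (JB n (1 : ℝ)))
  refine eq_zero_of_commute_JB_of_support hn hc le_rfl fun a c hac => ?_
  rw [Matrix.sub_apply, hT.lamCoeff_principal_support hn x le_rfl (by omega), if_pos rfl,
    JB_one_apply, bMat_apply_of_ne hac]
  ring

/-- This is the leading term of `T^{2n+1} = λ T`, read off from a given resolvent instead of
computed from the matrix. -/
lemma JB_one_pow (hn : 0 < 2 * n) (hq : ∀ x, ∀ i k : Fin (2 * n + 1), k < i → q x i k = 0)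
    (hT : IsResolvent n q T) : (JB n (1 : ℝ)) ^ (2 * n + 1) = JB n 1 := by
  have h1 := hT.hasTop_principal hn hq 0
  have h2 := congrArg (fun M => lamCoeff (principal n hn M) (2 * n + 1 : ℕ)) (hT.power 0)
  have h3 := (h1.pow (2 * n + 1)).2
  rw [mul_one] at h3
  simp only [map_pow, h3, principal_smul_lamVar] at h2
  rw [h2]
  ext a c
  rw [← h1.2]
  have : lamVar ^ (2 * n) = HahnSeries.single (-((2 * n : ℕ) : ℤ)) (1 : ℝ) := lamUnit_pow _
  simp only [lamCoeff, this, Matrix.map_apply, Matrix.smul_apply, smul_eq_mul,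
    HahnSeries.coeff_single_mul, one_mul]
  congr 1
  push_cast; ring

/-- The series `T(q, λ)` is unique. -/
theorem IsResolvent.unique (hn : 0 < 2 * n)
    (hq : ∀ x, ∀ i k : Fin (2 * n + 1), k < i → q x i k = 0) (hT : IsResolvent n q T)
    (hT' : IsResolvent n q T') : T = T' := by
  have h1 := hT.hasTop_principal hn hq
  have h1' := hT'.hasTop_principal hn hq
  have hpow := JB_one_pow hn hq hT
  have hlax : ∀ x i a c, HasDerivAt (fun y => lamCoeff (T y - T' y) i a c)
      (lamCoeff ((T x - T' x) * (JB n lamVar + (q x).map HahnSeries.C)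
        - (JB n lamVar + (q x).map HahnSeries.C) * (T x - T' x)) i a c) x := by
    intro x i a c
    have h := (hT.lax x i a c).fun_sub (hT'.lax x i a c)
    rw [← Matrix.sub_apply, ← lamCoeff_sub] at h
    simp only [lamCoeff_sub (T _), Matrix.sub_apply (lamCoeff (T _) i)]
    rwa [show ∀ L : Mat n (LaurentSeries ℝ), (T x - T' x) * L - L * (T x - T' x) =
      (T x * L - L * T x) - (T' x * L - L * T' x) from fun L => by
        rw [sub_mul, mul_sub]; abel]
  -- The degree of the difference in `μ` is pushed down one step at a time. The start is free, since
  -- both series have leading term `μ J_B(1)`.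
  have key : ∀ k : ℕ, ∀ x, ∀ i : ℤ, -(k : ℤ) < i →
      lamCoeff (principal n hn (T x - T' x)) i = 0 := by
    intro k
    induction k with
    | zero =>
      intro x i hi
      rw [map_sub, lamCoeff_sub]
      rcases eq_or_lt_of_le (show 1 ≤ i by simp at hi; omega) with rfl | hi1
      · rw [(h1 x).2, (h1' x).2, sub_self]
      · rw [(h1 x).1 i hi1, (h1' x).1 i hi1, sub_self]
    | succ k ih =>
      intro x i hi
      rcases lt_or_ge (-(k : ℤ)) i with hk | hk
      · exact ih x i hk
      have hc := commute_JB_of_lax hn hq hlax (m := i)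
        (fun x l hl => ih x l (by omega)) x
      set D := lamCoeff (principal n hn (T x - T' x)) i with hD
      have htop : HasTop (principal n hn (T x) - principal n hn (T' x)) i D := by
        rw [← map_sub]
        exact ⟨fun l hl => ih x l (by omega), rfl⟩
      -- With `J = J_B(1)`, the relation `T^{2n+1} = λ T` gives `D = (2n+1) J^{2n} D`. Multiplying
      -- by `J` and using `J^{2n+1} = J` yields `J D = (2n+1) J D`, so `J D = 0` and then `D = 0`.
      have h2 := ((h1 x).pow_sub_pow (h1' x) htop hc (2 * n)).2
      rw [← map_pow, ← map_pow, hT.power, hT'.power, principal_smul_lamVar, principal_smul_lamVar,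
        show lamVar ^ (2 * n) • principal n hn (T x) - lamVar ^ (2 * n) • principal n hn (T' x) =
          lamVar ^ (2 * n) • principal n hn (T x - T' x) by
            rw [map_sub]; ext; simp [mul_sub]] at h2
      have h3 : lamCoeff (lamVar ^ (2 * n) • principal n hn (T x - T' x)) ((2 * n : ℕ) + i) = D := by
        have : lamVar ^ (2 * n) = HahnSeries.single (-((2 * n : ℕ) : ℤ)) (1 : ℝ) := lamUnit_pow _
        ext a c
        simp only [hD, lamCoeff, this, Matrix.map_apply, Matrix.smul_apply, smul_eq_mul,
          HahnSeries.coeff_single_mul, one_mul]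
        congr 1
        ring
      rw [h3] at h2
      have h4 : JB n 1 * D = 0 := by
        have h5 : JB n 1 * D = ((2 * n + 1 : ℕ) : ℝ) • (JB n 1 * D) := by
          conv_lhs => rw [h2]
          rw [mul_smul_comm, ← mul_assoc, ← pow_succ', hpow]
        have h6 : ((2 * n : ℕ) : ℝ) • (JB n 1 * D) = 0 := by
          have : ((2 * n : ℕ) : ℝ) • (JB n 1 * D) =
            ((2 * n + 1 : ℕ) : ℝ) • (JB n 1 * D) - JB n 1 * D := by push_cast; module
          rw [this, ← h5, sub_self]
        exact (smul_eq_zero.1 h6).resolve_left (Nat.cast_ne_zero.2 hn.ne')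
      rw [h2, show JB n (1 : ℝ) ^ (2 * n) = JB n 1 ^ (2 * n - 1) * JB n 1 by
        rw [← pow_succ, Nat.sub_add_cancel hn], mul_assoc, h4, mul_zero, smul_zero]
  funext x
  refine sub_eq_zero.1 (principal_injective hn ?_)
  rw [map_zero]
  ext a c i
  have := congrFun₂ (key (i.toNat + 1) x (-i) (by omega)) a c
  simpa [lamCoeff] using this

end

/-! ### Uniqueness of frames, factorizations and dressed values. -/

section
variable {n : ℕ}

lemma rightInv_of_orth {K : Type*} [Field K] {M : Mat n K}
    (h : M.transpose * rho n K * M = rho n K) :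
    M * (rho n K * M.transpose * rho n K) = 1 :=
  mul_eq_one_comm.1 ((orth_iff M).1 h)

lemma hasDerivAt_mul_apply {A B : ℝ → Mat n ℂ} {A' B' : Mat n ℂ} {x : ℝ}
    (hA : ∀ a c, HasDerivAt (fun y => A y a c) (A' a c) x)
    (hB : ∀ a c, HasDerivAt (fun y => B y a c) (B' a c) x) (a c : Fin (2 * n + 1)) :
    HasDerivAt (fun y => (A y * B y) a c) ((A' * B x + A x * B') a c) x := by
  simp only [Matrix.mul_apply, Matrix.add_apply, ← Finset.sum_add_distrib]
  exact HasDerivAt.fun_sum fun l _ => (hA a l).mul (hB l c)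

/-- Two solutions of the same linear equation `A' = A L` differ by a constant matrix. -/
lemma hasDerivAt_mul_rightInv_eq_zero {A B : ℝ → Mat n ℂ} {L : Mat n ℂ} {x : ℝ}
    (hA : ∀ a c, HasDerivAt (fun y => A y a c) ((A x * L) a c) x)
    (hB : ∀ a c, HasDerivAt (fun y => B y a c) ((B x * L) a c) x)
    (ho : ∀ y, (B y).transpose * rho n ℂ * B y = rho n ℂ) (a c : Fin (2 * n + 1)) :
    HasDerivAt (fun y => (A y * (rho n ℂ * (B y).transpose * rho n ℂ)) a c) 0 x := by
  set R : ℝ → Mat n ℂ := fun y => rho n ℂ * (B y).transpose * rho n ℂ with hR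
  set R' : Mat n ℂ := rho n ℂ * (B x * L).transpose * rho n ℂ with hR'
  have hRd : ∀ a c, HasDerivAt (fun y => R y a c) (R' a c) x := by
    intro a c
    simp only [hR, hR', mul_rho_apply, rho_mul_apply, Matrix.transpose_apply]
    exact ((hB _ _).const_mul _).const_mul _
  have hBR : ∀ y, B y * R y = 1 := fun y => rightInv_of_orth (ho y)
  -- Orthogonality makes `R` the inverse of `B`; differentiating `B R = 1` gives `R' = -L R`, so the
  -- two terms in `(A R)'` cancel.
  have h1 : B x * L * R x + B x * R' = 0 := by
    ext a c
    have h := hasDerivAt_mul_apply hB hRd a c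
    simp only [hBR] at h
    exact h.unique (hasDerivAt_const x _)
  have h2 : R' = -(L * R x) := by
    have := congrArg (R x * ·) h1
    simp only [mul_add, ← mul_assoc, mul_eq_one_comm.1 (hBR x), one_mul, mul_zero] at this
    exact eq_neg_of_add_eq_zero_right this
  have h := hasDerivAt_mul_apply hA hRd a c
  rwa [h2, mul_neg, mul_assoc, add_neg_cancel, Matrix.zero_apply] at h

/-- The frame normalized at the origin is unique. -/
theorem IsFrame.unique {j : ℕ} (hn : 1 ≤ n) {q : ℝ → ℝ → Mat n ℝ} (hq : IsFlowSolution n j q)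
    {F G : ℝ → ℝ → ℂ → Mat n ℂ} (hF : IsFrame n j q F) (hG : IsFrame n j q G)
    (hF0 : ∀ z, F 0 0 z = 1) (hG0 : ∀ z, G 0 0 z = 1) : F = G := by
  obtain ⟨T, hT, hFt⟩ := hF.deriv_t
  obtain ⟨T', hT', hGt⟩ := hG.deriv_t
  have hTT : T = T' := by
    funext x t
    exact congrFun ((hT t).unique (by omega) (fun x => (hq.borel x t).2) (hT' t)) x
  subst hTT
  funext x t z
  -- `F G⁻¹` is constant in `x`, and on the line `x = 0` constant in `t`.
  have hx : ∀ a c t, (F x t z * (rho n ℂ * (G x t z).transpose * rho n ℂ)) a c =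
      (F 0 t z * (rho n ℂ * (G 0 t z).transpose * rho n ℂ)) a c := by
    intro a c t
    have h := fun x => hasDerivAt_mul_rightInv_eq_zero (hF.deriv_x x t z) (hG.deriv_x x t z)
      (fun y => (hG.entire y t).orth z) a c
    exact is_const_of_deriv_eq_zero (fun x => (h x).differentiableAt) (fun x => (h x).deriv) x 0
  have ht : ∀ a c, (F 0 t z * (rho n ℂ * (G 0 t z).transpose * rho n ℂ)) a c =
      (F 0 0 z * (rho n ℂ * (G 0 0 z).transpose * rho n ℂ)) a c := by
    intro a c
    have h := fun t => hasDerivAt_mul_rightInv_eq_zero (hFt 0 t z) (hGt 0 t z)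
      (fun y => (hG.entire 0 y).orth z) a c
    exact is_const_of_deriv_eq_zero (fun x => (h x).differentiableAt) (fun x => (h x).deriv) t 0
  have h1 : F x t z * (rho n ℂ * (G x t z).transpose * rho n ℂ) = 1 := by
    ext a c
    rw [hx, ht, hF0, hG0, Matrix.transpose_one, mul_one, rho_mul_rho, mul_one]
  calc F x t z = F x t z * (rho n ℂ * (G x t z).transpose * rho n ℂ) * G x t z := by
        rw [mul_assoc, (orth_iff _).1 ((hG.entire x t).orth z), mul_one]
    _ = G x t z := by rw [h1, one_mul]

/-- The factorization into an entire loop and a rational loop is unique. -/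
theorem factorization_unique {F F' f f' : ℂ → Mat n ℂ} (hF : IsEntireLoop n F)
    (hF' : IsEntireLoop n F') (hf : IsRationalLoop n f) (hf' : IsRationalLoop n f')
    (h : ∀ᶠ z in cofinite, F z * f z = F' z * f' z) : ∀ᶠ z in cofinite, f z = f' z := by
  -- `R` is `F'⁻¹ F`, entire by construction; it equals `f' f⁻¹` off a finite set, so it tends to
  -- the identity at infinity and Liouville applies.
  set R : ℂ → Mat n ℂ := fun z => rho n ℂ * (F' z).transpose * rho n ℂ * F z with hR
  have hle : Bornology.cobounded ℂ ≤ cofinite := Bornology.le_cofinite ℂ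
  have hRf : ∀ᶠ z in cofinite, R z = f' z * (rho n ℂ * (f z).transpose * rho n ℂ) := by
    filter_upwards [h, hf.orth] with z hz hfz
    calc R z = rho n ℂ * (F' z).transpose * rho n ℂ * (F z * f z) *
          (rho n ℂ * (f z).transpose * rho n ℂ) := by
          simp only [hR]
          rw [mul_assoc _ (F z * f z), mul_assoc (F z), rightInv_of_orth hfz, mul_one]
      _ = _ := by rw [hz, ← mul_assoc _ (F' z), (orth_iff _).1 (hF'.orth z), one_mul]
  have hlim : Tendsto R (Bornology.cobounded ℂ) (𝓝 1) := by
    have h1 : Tendsto (fun z => f' z * (rho n ℂ * (f z).transpose * rho n ℂ))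
        (Bornology.cobounded ℂ) (𝓝 (1 * (rho n ℂ * (1 : Mat n ℂ).transpose * rho n ℂ))) := by
      refine hf'.at_infinity.mul ((Tendsto.mul tendsto_const_nhds ?_).mul tendsto_const_nhds)
      exact (continuous_id.matrix_transpose.tendsto (1 : Mat n ℂ)).comp hf.at_infinity
    rw [Matrix.transpose_one, mul_one, rho_mul_rho, mul_one] at h1
    exact h1.congr' ((hRf.filter_mono hle).mono fun z hz => hz.symm)
  have hR1 : ∀ z, R z = 1 := by
    intro z
    ext a c
    have hd : Differentiable ℂ fun z => R z a c := by
      simp only [hR, Matrix.mul_apply (M := rho n ℂ * _ * _), mul_rho_apply, rho_mul_apply,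
        Matrix.transpose_apply]
      exact Differentiable.fun_sum fun l _ =>
        (((hF'.holo _ _).const_mul _).const_mul _).mul (hF.holo _ _)
    have hl : Tendsto (fun z => R z a c) (cocompact ℂ) (𝓝 ((1 : Mat n ℂ) a c)) := by
      rw [← Metric.cobounded_eq_cocompact]
      exact ((continuous_id.matrix_elem a c).tendsto (1 : Mat n ℂ)).comp hlim
    exact hd.apply_eq_of_tendsto_cocompact z hl
  filter_upwards [h] with z hz
  have h1 := congrArg (rho n ℂ * (F' z).transpose * rho n ℂ * ·) hz
  simp only [← mul_assoc] at h1
  rw [(orth_iff _).1 (hF'.orth z), one_mul] at h1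
  rw [← h1]
  exact (by rw [show rho n ℂ * (F' z).transpose * rho n ℂ * F z = 1 from hR1 z, one_mul])

lemma toC_injective : Function.Injective (toC : Mat n ℝ → Mat n ℂ) :=
  Matrix.map_injective Complex.ofReal_injective

/-- The value of `f • q` at a point is unique. -/
theorem IsDressedValue.unique {j : ℕ} (hn : 1 ≤ n) {f : ℂ → Mat n ℂ} {q : ℝ → ℝ → Mat n ℝ}
    {x t : ℝ} {v w : Mat n ℝ} (hv : IsDressedValue n j f q x t v)
    (hw : IsDressedValue n j f q x t w) : v = w := by
  obtain ⟨-, hq, F, hF, hF0, F₁, f₁, A, hF₁, hf₁, h₁, hA, rfl⟩ := hv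
  obtain ⟨-, -, G, hG, hG0, F₂, f₂, B, hF₂, hf₂, h₂, hB, rfl⟩ := hw
  obtain rfl := hF.unique hn hq hG hF0 hG0
  have h := factorization_unique hF₁ hF₂ hf₁ hf₂ (by
    filter_upwards [h₁, h₂] with z hz₁ hz₂
    rw [← hz₁, ← hz₂])
  have hAB : A = B := by
    refine toC_injective (tendsto_nhds_unique hA (hB.congr' ?_))
    filter_upwards [Bornology.le_cofinite ℂ h] with z hz
    rw [hz]
  rw [hAB]

end

/-! ### Scaling of the series `T` and of solutions of the flow. -/

section
variable {n : ℕ}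

/-- The substitution `λ ↦ c λ` in Laurent series in `λ⁻¹`. -/
def rescaleLam (c : ℝˣ) : LaurentSeries ℝ →+* LaurentSeries ℝ where
  toFun s :=
    { coeff := fun i => ((c ^ (-i) : ℝˣ) : ℝ) * s.coeff i
      isPWO_support' := s.isPWO_support'.mono fun i hi => right_ne_zero_of_mul hi }
  map_one' := by
    ext i
    by_cases h : i = 0 <;> simp [HahnSeries.coeff_one, h]
  map_mul' s u := by
    ext i
    simp only [HahnSeries.coeff_mul, Finset.mul_sum]
    refine Finset.sum_congr ?_ fun p hp => ?_
    · ext p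
      have hc : ∀ i : ℤ, (c : ℝ) ^ i ≠ 0 := fun i => zpow_ne_zero i c.ne_zero
      simp [Finset.mem_antidiagonal, HahnSeries.mem_support, hc]
    · rw [Finset.mem_antidiagonal] at hp
      rw [← hp.2.2, neg_add, zpow_add, Units.val_mul]
      ring
  map_zero' := by ext; simp
  map_add' s u := by ext; simp [mul_add]

lemma rescaleLam_coeff (c : ℝˣ) (s : LaurentSeries ℝ) (i : ℤ) :
    (rescaleLam c s).coeff i = ((c ^ (-i) : ℝˣ) : ℝ) * s.coeff i := rfl

lemma rescaleLam_lamVar (c : ℝˣ) : rescaleLam c lamVar = HahnSeries.C (c : ℝ) * lamVar := by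
  ext i
  rw [rescaleLam_coeff, HahnSeries.C_mul_eq_smul, HahnSeries.coeff_smul]
  by_cases h : i = -1 <;> simp [lamVar, h]

lemma rescaleLam_C (c : ℝˣ) (a : ℝ) : rescaleLam c (HahnSeries.C a) = HahnSeries.C a := by
  ext i
  rw [rescaleLam_coeff]
  by_cases h : i = 0 <;> simp [h]

/-- A real unit as a constant series. -/
abbrev cUnit (r : ℝˣ) : (LaurentSeries ℝ)ˣ :=
  Units.map ((HahnSeries.C : ℝ →+* LaurentSeries ℝ) : ℝ →* LaurentSeries ℝ) r

/-- `M(λ) ↦ Γ(r)⁻¹ M(r^{-2n} λ) Γ(r)`. -/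
def twist (n : ℕ) (r : ℝˣ) : Mat n (LaurentSeries ℝ) →+* Mat n (LaurentSeries ℝ) :=
  (gconj n (cUnit r)).toRingHom.comp (rescaleLam (r ^ (2 * n))⁻¹).mapMatrix

lemma twist_eq (r : ℝˣ) (M : Mat n (LaurentSeries ℝ)) :
    twist n r M = gconj n (cUnit r) (M.map (rescaleLam (r ^ (2 * n))⁻¹)) := rfl

/-- The real number `a` as a scalar matrix of series. -/
def scal (n : ℕ) : ℝ →+* Mat n (LaurentSeries ℝ) :=
  (Matrix.scalar (Fin (2 * n + 1))).comp (HahnSeries.C : ℝ →+* LaurentSeries ℝ)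

lemma scal_mul_apply (s : ℝ) (M : Mat n (LaurentSeries ℝ)) (a c : Fin (2 * n + 1)) :
    (scal n s * M) a c = HahnSeries.C s * M a c := by
  simp [scal]

lemma scal_commute (s : ℝ) (M : Mat n (LaurentSeries ℝ)) : scal n s * M = M * scal n s :=
  Matrix.scalar_commute (HahnSeries.C s) (fun _ => Commute.all _ _) M

lemma scal_mul_mul_scal_mul (s u : ℝ) (M N : Mat n (LaurentSeries ℝ)) :
    (scal n s * M) * (scal n u * N) = scal n (s * u) * (M * N) := by
  rw [mul_assoc, ← mul_assoc M, ← scal_commute, mul_assoc, ← mul_assoc, ← map_mul]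

lemma scal_mul_scal_mul (s u : ℝ) (M : Mat n (LaurentSeries ℝ)) :
    scal n s * (scal n u * M) = scal n (s * u) * M := by
  rw [← mul_assoc, ← map_mul]

lemma lamCoeff_scal_mul (s : ℝ) (M : Mat n (LaurentSeries ℝ)) (i : ℤ) :
    lamCoeff (scal n s * M) i = s • lamCoeff M i := by
  ext a c
  simp only [lamCoeff, Matrix.map_apply, scal_mul_apply, Matrix.smul_apply]
  rw [HahnSeries.C_mul_eq_smul, HahnSeries.coeff_smul]

lemma scal_mul_eq_smul (s : ℝ) (M : Mat n (LaurentSeries ℝ)) :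
    scal n s * M = (HahnSeries.C s : LaurentSeries ℝ) • M := by
  ext1 a c
  exact scal_mul_apply s M a c

lemma scal_mul_lamVar_smul (s : ℝ) (M : Mat n (LaurentSeries ℝ)) :
    scal n s * (lamVar • M) = lamVar • (scal n s * M) := by
  ext1 a c
  rw [scal_mul_apply, Matrix.smul_apply, Matrix.smul_apply, scal_mul_apply]
  exact mul_left_comm _ _ _

lemma lamCoeff_twist (r : ℝˣ) (M : Mat n (LaurentSeries ℝ)) (i : ℤ) :
    lamCoeff (twist n r M) i =
      ((((r ^ (2 * n))⁻¹ ^ i : ℝˣ)) : ℝ) • gconj n r (lamCoeff M i) := by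
  ext a c
  have h : ∀ (s : ℝˣ) (k : ℕ), (cUnit s : LaurentSeries ℝ) ^ k = HahnSeries.C ((s : ℝ) ^ k) :=
    fun s k => by simp
  simp only [twist_eq, lamCoeff, gconj_apply, Matrix.map_apply, Matrix.smul_apply]
  rw [← map_inv, h, h, mul_comm _ (HahnSeries.C _), HahnSeries.C_mul_eq_smul,
    HahnSeries.C_mul_eq_smul, HahnSeries.coeff_smul, HahnSeries.coeff_smul, rescaleLam_coeff,
    neg_neg, smul_eq_mul, smul_eq_mul, smul_eq_mul]
  ring

lemma twist_lamVar_smul (r : ℝˣ) (M : Mat n (LaurentSeries ℝ)) :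
    twist n r (lamVar • M) =
      scal n (((r ^ (2 * n))⁻¹ : ℝˣ) : ℝ) * (lamVar • twist n r M) := by
  rw [twist_eq, twist_eq, Matrix.map_smul' _ _ _ (map_mul _), map_smul, rescaleLam_lamVar,
    scal_mul_eq_smul]
  ext1 a c
  exact mul_assoc _ _ _

lemma scal_mul_twist_lax (r : ℝˣ) (q : Mat n ℝ) :
    scal n r * twist n r (JB n lamVar + q.map HahnSeries.C) =
      JB n lamVar + ((r : ℝ) • gconj n r q).map HahnSeries.C := by
  have hJ : scal n r * twist n r (JB n lamVar) = JB n lamVar := by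
    have h := smul_gconj_JB (n := n) (cUnit r) (HahnSeries.C (((r ^ (2 * n))⁻¹ : ℝˣ) : ℝ) * lamVar)
    rw [scal_mul_eq_smul, twist_eq, map_JB, rescaleLam_lamVar]
    refine h.trans ?_
    congr 1
    have : (r : ℝ) ^ (2 * n) * (((r ^ (2 * n))⁻¹ : ℝˣ) : ℝ) = 1 := by
      rw [← Units.val_pow_eq_pow_val, Units.mul_inv]
    rw [← mul_assoc, Units.coe_map, MonoidHom.coe_coe, ← map_pow, ← map_mul, this, map_one,
      one_mul]
  have hq : scal n r * twist n r (q.map HahnSeries.C) =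
      ((r : ℝ) • gconj n r q).map HahnSeries.C := by
    have h : (q.map HahnSeries.C).map (rescaleLam (r ^ (2 * n))⁻¹) =
        q.map (HahnSeries.C : ℝ →+* LaurentSeries ℝ) := by
      ext1 a c
      exact rescaleLam_C _ _
    rw [twist_eq, h, ← gconj_map, scal_mul_eq_smul]
    exact (Matrix.map_smul' _ _ _ (map_mul _)).symm
  rw [map_add, mul_add, hJ, hq]

lemma scal_mul_twist_pow (r : ℝˣ) (T : Mat n (LaurentSeries ℝ)) (k : ℕ) :
    (scal n r * twist n r T) ^ k = scal n ((r : ℝ) ^ k) * twist n r (T ^ k) := by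
  rw [Commute.mul_pow (scal_commute _ _), map_pow, map_pow]

lemma lamCoeff_scal_mul_twist_pow (r : ℝˣ) (T : Mat n (LaurentSeries ℝ)) (k : ℕ) (i : ℤ) :
    lamCoeff ((scal n r * twist n r T) ^ k) i =
      ((r : ℝ) ^ k * (((r ^ (2 * n))⁻¹ ^ i : ℝˣ) : ℝ)) • gconj n r (lamCoeff (T ^ k) i) := by
  rw [scal_mul_twist_pow, lamCoeff_scal_mul, lamCoeff_twist, smul_smul]

lemma skew_twist (r : ℝˣ) {T : Mat n (LaurentSeries ℝ)}
    (h : T.transpose * rho n (LaurentSeries ℝ) + rho n (LaurentSeries ℝ) * T = 0) :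
    (scal n r * twist n r T).transpose * rho n (LaurentSeries ℝ) +
      rho n (LaurentSeries ℝ) * (scal n r * twist n r T) = 0 := by
  have h1 := congrArg (fun M => M.map (rescaleLam (r ^ (2 * n))⁻¹)) h
  have hrho : (rho n (LaurentSeries ℝ)).map (rescaleLam (r ^ (2 * n))⁻¹) = rho n _ := by
    ext1 a c
    simp only [rho, Matrix.map_apply, Matrix.of_apply]
    split_ifs <;> simp
  simp only [Matrix.map_add _ (map_add _), Matrix.map_mul, hrho,
    Matrix.map_zero _ (map_zero _), Matrix.transpose_map] at h1
  have h2 := skew_gconj (cUnit r) h1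
  have ht : (scal n (r : ℝ)).transpose = scal n r := by simp [scal]
  rw [Matrix.transpose_mul, ht, ← scal_commute, mul_assoc, ← mul_assoc (rho n _),
    ← scal_commute, mul_assoc, ← mul_add, twist_eq]
  erw [h2]
  rw [mul_zero]

/-- Stated over a normed algebra so as to serve both real series coefficients and complex frames. -/
lemma hasDerivAt_smul_gconj_comp {𝕜 : Type*} [NormedField 𝕜] [NormedAlgebra ℝ 𝕜]
    {A : ℝ → Mat n 𝕜} {D : Mat n 𝕜} (s : 𝕜ˣ) (k : 𝕜) {m x : ℝ}
    (h : ∀ a c, HasDerivAt (fun y => A y a c) (D a c) (m * x)) (a c : Fin (2 * n + 1)) :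
    HasDerivAt (fun y => (k • gconj n s (A (m * y))) a c)
      ((k • (algebraMap ℝ 𝕜 m • gconj n s D)) a c) x := by
  have h2 := (h a c).scomp x ((hasDerivAt_id x).const_mul m)
  have h3 := ((h2.const_mul ((↑s⁻¹ : 𝕜) ^ (a : ℕ))).mul_const ((s : 𝕜) ^ (c : ℕ))).const_mul k
  refine HasDerivAt.congr_deriv h3 ?_
  rw [Matrix.smul_apply, Matrix.smul_apply, gconj_apply, Algebra.smul_def, mul_one, smul_eq_mul,
    smul_eq_mul]
  ring

/-- In the Lax equation the chain rule supplies the second factor `r` of the commutator. In the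
power relation `r^{2n+1}` meets the `r^{-2n}` coming from `λ`, leaving one `r`. -/
lemma IsResolvent.scale {q : ℝ → Mat n ℝ} {T : ℝ → Mat n (LaurentSeries ℝ)}
    (h : IsResolvent n q T) (r : ℝˣ) :
    IsResolvent n (fun x => (r : ℝ) • gconj n r (q (r * x)))
      (fun x => scal n r * twist n r (T (r * x))) := by
  have hc : ∀ x i, lamCoeff (scal n r * twist n r (T (r * x))) i =
      (r * (((r ^ (2 * n))⁻¹ ^ i : ℝˣ) : ℝ)) • gconj n r (lamCoeff (T (r * x)) i) := by
    intro x i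
    rw [lamCoeff_scal_mul, lamCoeff_twist, smul_smul]
  refine ⟨?_, ?_, fun x => skew_twist r (h.skew _), ?_, ?_⟩
  · intro x i hi
    rw [hc, h.degree_le _ i hi, map_zero, smul_zero]
  · intro x
    rw [hc, h.leading, mul_comm (r : ℝ), ← smul_smul, smul_gconj_beta, smul_smul, zpow_one,
      ← Units.val_pow_eq_pow_val, Units.inv_mul, one_smul]
  · intro x i a c
    have h1 : ∀ T : Mat n (LaurentSeries ℝ), lamCoeff
        ((scal n r * twist n r T) *
          (JB n lamVar + ((r : ℝ) • gconj n r (q (r * x))).map HahnSeries.C) -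
        (JB n lamVar + ((r : ℝ) • gconj n r (q (r * x))).map HahnSeries.C) *
          (scal n r * twist n r T)) i =
        ((r : ℝ) * r * (((r ^ (2 * n))⁻¹ ^ i : ℝˣ) : ℝ)) • gconj n r (lamCoeff
          (T * (JB n lamVar + (q (r * x)).map HahnSeries.C) -
            (JB n lamVar + (q (r * x)).map HahnSeries.C) * T) i) := by
      intro T
      rw [← scal_mul_twist_lax, scal_mul_mul_scal_mul, scal_mul_mul_scal_mul, ← map_mul,
        ← map_mul, ← mul_sub, ← map_sub, lamCoeff_scal_mul, lamCoeff_twist, smul_smul]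
    rw [h1]
    simp only [hc]
    refine (hasDerivAt_smul_gconj_comp r _ (h.lax (r * x) i) a c).congr_deriv ?_
    rw [smul_smul, Algebra.algebraMap_self_apply, mul_right_comm]
  · intro x
    rw [scal_mul_twist_pow, h.power, twist_lamVar_smul, scal_mul_scal_mul, scal_mul_lamVar_smul,
      pow_succ, mul_right_comm, ← Units.val_pow_eq_pow_val, Units.mul_inv, one_mul]

lemma isBorel_scale (r : ℝˣ) {A : Mat n ℝ} (h : IsBorel n A) :
    IsBorel n ((r : ℝ) • gconj n r A) := by
  constructor
  · rw [Matrix.transpose_smul, smul_mul_assoc, mul_smul_comm, ← smul_add, skew_gconj r h.1,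
      smul_zero]
  · intro i k hik
    rw [Matrix.smul_apply, gconj_apply, h.2 i k hik, mul_zero, zero_mul, smul_zero]

/-- The series of `r ⊙ q`. -/
lemma isResolvent_scale {j : ℕ} {q : ℝ → ℝ → Mat n ℝ} {T : ℝ → ℝ → Mat n (LaurentSeries ℝ)}
    (hT : ∀ t, IsResolvent n (fun x => q x t) (fun x => T x t)) (r : ℝˣ) (t : ℝ) :
    IsResolvent n (fun x => scale n j r q x t)
      (fun x => scal n r * twist n r (T (r * x) (r ^ (2 * j - 1) * t))) := by
  simp only [scale_apply]
  exact (hT (r ^ (2 * j - 1) * t)).scale r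

theorem IsFlowSolution.scale {j : ℕ} {q : ℝ → ℝ → Mat n ℝ} (h : IsFlowSolution n j q) (r : ℝˣ) :
    IsFlowSolution n j (scale n j r q) := by
  refine ⟨?_, ?_, ?_⟩
  · intro a c
    simp only [scale_apply, Matrix.smul_apply, gconj_apply, smul_eq_mul]
    refine contDiff_const.mul ((contDiff_const.mul ?_).mul contDiff_const)
    exact (h.smooth a c).comp (f := fun p : ℝ × ℝ => ((r : ℝ) * p.1, (r : ℝ) ^ (2 * j - 1) * p.2))
      (by fun_prop)
  · intro x t
    rw [scale_apply]
    exact isBorel_scale r (h.borel _ _)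
  · obtain ⟨T, hT, hflow⟩ := h.flow
    refine ⟨_, isResolvent_scale hT r, fun x t a c => ?_⟩
    set k := 2 * j - 1
    have h1 := hflow (r * x) (r ^ k * t)
    set M := lamCoeff (T (r * x) (r ^ k * t) ^ k) 0
    set Q := q (r * x) (r ^ k * t)
    have hb : bMat n ℝ + BnFlow.scale n j r q x t = (r : ℝ) • gconj n r (bMat n ℝ + Q) := by
      rw [map_add, smul_add, smul_gconj_bMat, scale_apply]
    have h2 : deriv (fun y => lamCoeff ((scal n r *
          twist n r (T (r * y) (r ^ k * t))) ^ k) 0 a c) x =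
        (r : ℝ) ^ k * ((↑r⁻¹ : ℝ) ^ (a : ℕ) * ((r : ℝ) *
          deriv (fun y => lamCoeff (T y (r ^ k * t) ^ k) 0 a c) (r * x)) * (r : ℝ) ^ (c : ℕ)) := by
      simp only [lamCoeff_scal_mul_twist_pow, zpow_zero, Units.val_one, mul_one, Matrix.smul_apply,
        gconj_apply, smul_eq_mul]
      rw [deriv_const_mul_field, deriv_mul_const_field, deriv_const_mul_field,
        deriv_comp_mul_left (r : ℝ) (fun y => lamCoeff (T y (r ^ k * t) ^ k) 0 a c), smul_eq_mul]
    -- In degree 0 in `λ` the rescaling is invisible, so the right side of the flow scales by `r ·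
    -- r^{2j-1}`: one `r` from the operator `∂_x + b + q`, and `r^{2j-1}` matching the scaling of
    -- time.
    rw [h2, lamCoeff_scal_mul_twist_pow, hb, zpow_zero, Units.val_one, mul_one, smul_mul_smul_comm,
      smul_mul_smul_comm, ← map_mul, ← map_mul, mul_comm ((r : ℝ) ^ k) (r : ℝ), ← smul_sub, ← map_sub]
    simp only [BnFlow.scale_apply]
    refine (hasDerivAt_smul_gconj_comp r (r : ℝ) (D := Matrix.of fun a c =>
      deriv (fun y => lamCoeff (T y (r ^ k * t) ^ k) 0 a c) (r * x) +
        ((bMat n ℝ + Q) * M - M * (bMat n ℝ + Q)) a c) h1 a c).congr_deriv ?_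
    simp only [Matrix.smul_apply, gconj_apply, Matrix.of_apply, smul_eq_mul,
      Algebra.algebraMap_self_apply, M]
    ring

end

/-! ### Scaling of loops, frames and the dressing action. -/

section
variable {n : ℕ}

/-- A real unit as a complex one. -/
abbrev cxUnit (r : ℝˣ) : ℂˣ := Units.map (Complex.ofRealHom : ℝ →* ℂ) r

/-- The complex number `r^{-2n}`. -/
def twistFactor (n : ℕ) (r : ℝˣ) : ℂ := (((r ^ (2 * n))⁻¹ : ℝˣ) : ℝ)

lemma pow_mul_twistFactor (r : ℝˣ) : ((r : ℝ) : ℂ) ^ (2 * n) * twistFactor n r = 1 := by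
  rw [twistFactor, ← Complex.ofReal_pow, ← Complex.ofReal_mul, ← Units.val_pow_eq_pow_val,
    Units.mul_inv, Complex.ofReal_one]

lemma twistFactor_ne_zero (r : ℝˣ) : twistFactor n r ≠ 0 :=
  right_ne_zero_of_mul (pow_mul_twistFactor r ▸ one_ne_zero)

lemma twistFactor_inv_mul (r : ℝˣ) : twistFactor n r⁻¹ * twistFactor n r = 1 := by
  rw [twistFactor, twistFactor, ← Complex.ofReal_mul, ← Units.val_mul, inv_pow, inv_inv,
    mul_inv_cancel, Units.val_one, Complex.ofReal_one]

/-- `f ↦ Γ(r)⁻¹ f(r^{-2n} λ) Γ(r)`. -/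
def conjLoop (r : ℝˣ) (f : ℂ → Mat n ℂ) : ℂ → Mat n ℂ := fun z =>
  gconj n (cxUnit r) (f (twistFactor n r * z))

lemma conjLoop_inv_conjLoop (r : ℝˣ) (f : ℂ → Mat n ℂ) : conjLoop r⁻¹ (conjLoop r f) = f := by
  funext z
  rw [conjLoop, conjLoop, ← mul_assoc, mul_comm (twistFactor n r), twistFactor_inv_mul, one_mul,
    show cxUnit r⁻¹ = (cxUnit r)⁻¹ from map_inv _ r, gconj_inv_gconj]

lemma star_twistFactor_mul (r : ℝˣ) (z : ℂ) :
    twistFactor n r * star z = star (twistFactor n r * z) := by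
  rw [star_mul', twistFactor]
  congr 1
  exact (Complex.conj_ofReal _).symm

lemma gconj_map_star (r : ℝˣ) (M : Mat n ℂ) :
    (gconj n (cxUnit r) M).map star = gconj n (cxUnit r) (M.map star) := by
  have h := gconj_map (starRingEnd ℂ) (cxUnit r) M
  have h' : Units.map (starRingEnd ℂ : ℂ →* ℂ) (cxUnit r) = cxUnit r := by
    ext
    exact Complex.conj_ofReal _
  rw [h'] at h
  exact h

lemma toC_smul (a : ℝ) (M : Mat n ℝ) : toC (a • M) = (a : ℂ) • toC M := by
  ext; simp [toC]

lemma toC_add (A B : Mat n ℝ) : toC (A + B) = toC A + toC B := by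
  ext; simp [toC]

lemma toC_mul (A B : Mat n ℝ) : toC (A * B) = toC A * toC B :=
  Matrix.map_mul (f := Complex.ofRealHom)

lemma toC_zero : toC (0 : Mat n ℝ) = 0 := by
  ext; simp [toC]

lemma IsEntireLoop.conjLoop {f : ℂ → Mat n ℂ} (h : IsEntireLoop n f) (r : ℝˣ) :
    IsEntireLoop n (conjLoop r f) := by
  refine ⟨fun a c => ?_, fun z => orth_gconj _ (h.orth _), fun z => ?_⟩
  · simp only [BnFlow.conjLoop, gconj_apply]
    exact (((h.holo a c).comp (differentiable_id.const_mul _)).const_mul _).mul_const _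
  · rw [BnFlow.conjLoop, BnFlow.conjLoop, gconj_map_star, star_twistFactor_mul, h.real]

lemma tendsto_twist_cofinite (r : ℝˣ) :
    Tendsto (fun z => twistFactor n r * z) cofinite cofinite :=
  (mul_right_injective₀ (twistFactor_ne_zero r)).tendsto_cofinite

lemma tendsto_twist_cobounded (r : ℝˣ) :
    Tendsto (fun z => twistFactor n r * z) (Bornology.cobounded ℂ) (Bornology.cobounded ℂ) :=
  tendsto_mul_left_cobounded (twistFactor_ne_zero r)

lemma continuous_gconj (s : ℂˣ) : Continuous (gconj n s) := by
  refine continuous_matrix fun a c => ?_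
  simp only [gconj_apply]
  fun_prop

lemma IsRationalLoop.conjLoop {f : ℂ → Mat n ℂ} (h : IsRationalLoop n f) (r : ℝˣ) :
    IsRationalLoop n (conjLoop r f) := by
  refine ⟨?_, ?_, ?_, ?_⟩
  · obtain ⟨d, N, hd, hN⟩ := h.rational
    set p : Polynomial ℂ := Polynomial.C (twistFactor n r) * Polynomial.X with hp
    refine ⟨d.comp p, Matrix.of fun a c => Polynomial.C ((↑(cxUnit r)⁻¹ : ℂ) ^ (a : ℕ)) *
      (N a c).comp p * Polynomial.C ((cxUnit r : ℂ) ^ (c : ℕ)), ?_, ?_⟩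
    · intro h0
      rcases Polynomial.comp_eq_zero_iff.1 h0 with h1 | h1
      · exact hd h1
      · have := congrArg (fun q => Polynomial.coeff q 1) h1.2
        simp [hp, twistFactor_ne_zero] at this
    · intro z hz
      have hpz : p.eval z = twistFactor n r * z := by simp [hp]
      rw [Polynomial.eval_comp, hpz] at hz ⊢
      rw [BnFlow.conjLoop, hN _ hz]
      ext a c
      simp [gconj_apply, hpz]
      ring
  · have h1 := ((continuous_gconj (cxUnit r)).tendsto (1 : Mat n ℂ)).comp
      (h.at_infinity.comp (tendsto_twist_cobounded (n := n) r))
    rwa [map_one] at h1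
  · filter_upwards [(tendsto_twist_cofinite r).eventually h.orth] with z hz
    exact orth_gconj _ hz
  · filter_upwards [(tendsto_twist_cofinite r).eventually h.real] with z hz
    rw [BnFlow.conjLoop, BnFlow.conjLoop, gconj_map_star, star_twistFactor_mul, hz]

/-- The twist acts degree by degree in `λ`, hence commutes with truncation to nonnegative powers. -/
lemma polyPart_scale (r : ℝˣ) (T : Mat n (LaurentSeries ℝ)) (N k : ℕ) (z : ℂ) :
    polyPart N ((scal n r * twist n r T) ^ k) z =
      (((r : ℝ) ^ k : ℝ) : ℂ) • gconj n (cxUnit r) (polyPart N (T ^ k) (twistFactor n r * z)) := by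
  simp only [polyPart, map_sum, Finset.smul_sum]
  refine Finset.sum_congr rfl fun i _ => ?_
  rw [lamCoeff_scal_mul_twist_pow, toC_smul, toC_gconj, map_smul, smul_smul, smul_smul,
    zpow_natCast, Units.val_pow_eq_pow_val, Complex.ofReal_mul, Complex.ofReal_pow _ i, mul_pow]
  congr 1
  rw [twistFactor]
  ring

theorem IsFrame.scale {j : ℕ} {q : ℝ → ℝ → Mat n ℝ} {F : ℝ → ℝ → ℂ → Mat n ℂ}
    (h : IsFrame n j q F) (r : ℝˣ) :
    IsFrame n j (scale n j r q) (fun x t => conjLoop r (F (r * x) (r ^ (2 * j - 1) * t))) := by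
  refine ⟨fun x t => (h.entire _ _).conjLoop r, fun x t z => ?_, fun x t z a c => ?_, ?_⟩
  · rw [conjLoop, det_gconj, h.det_eq_one]
  · have h1 := hasDerivAt_smul_gconj_comp (cxUnit r) 1
      (h.deriv_x (r * x) (r ^ (2 * j - 1) * t) (twistFactor n r * z)) a c
    simp only [one_smul] at h1
    refine h1.congr_deriv ?_
    have h2 : JB n z + toC (BnFlow.scale n j r q x t) = (r : ℂ) • gconj n (cxUnit r)
        (JB n (twistFactor n r * z) + toC (q (r * x) (r ^ (2 * j - 1) * t))) := by
      have h3 := smul_gconj_JB (n := n) (cxUnit r) (twistFactor n r * z)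
      rw [map_add, smul_add, scale_apply, toC_smul, toC_gconj]
      congr 1
      rw [← mul_assoc] at h3
      refine Eq.trans ?_ h3.symm
      congr 1
      exact (by rw [show (cxUnit r : ℂ) = ((r : ℝ) : ℂ) from rfl, pow_mul_twistFactor, one_mul])
    rw [h2, conjLoop, mul_smul_comm, ← map_mul]
    rfl
  · obtain ⟨T, hT, hFt⟩ := h.deriv_t
    refine ⟨_, isResolvent_scale hT r, fun x t z a c => ?_⟩
    have h1 := hasDerivAt_smul_gconj_comp (cxUnit r) 1
      (hFt (r * x) (r ^ (2 * j - 1) * t) (twistFactor n r * z)) a c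
    simp only [one_smul] at h1
    refine h1.congr_deriv ?_
    rw [polyPart_scale, conjLoop, mul_smul_comm, ← map_mul]
    rfl

/-- The action of rational loops is compatible with the scaling transform. -/
theorem IsDressedValue.scale {j : ℕ} {f : ℂ → Mat n ℂ} {q : ℝ → ℝ → Mat n ℝ} {x t : ℝ}
    {v : Mat n ℝ} (r : ℝˣ)
    (h : IsDressedValue n j f q (r * x) (r ^ (2 * j - 1) * t) v) :
    IsDressedValue n j (conjLoop r f) (scale n j r q) x t ((r : ℝ) • gconj n r v) := by
  obtain ⟨hf, hq, F, hF, hF0, F', f', A, hF', hf', hfac, hA, rfl⟩ := h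
  -- Replacing `λ` by `r^{-2n} λ` multiplies the coefficient of `λ⁻¹` by `r^{2n}`. This factor is
  -- absorbed by `r^{2n} β = r Γ(r)⁻¹ β Γ(r)` in the commutator with `β`.
  refine ⟨hf.conjLoop r, hq.scale r, _, hF.scale r, fun z => ?_, conjLoop r F', conjLoop r f',
    (r : ℝ) ^ (2 * n) • gconj n r A, hF'.conjLoop r, hf'.conjLoop r, ?_, ?_, ?_⟩
  · rw [mul_zero, mul_zero, conjLoop, hF0, map_one]
  · filter_upwards [(tendsto_twist_cofinite (n := n) r).eventually hfac] with z hz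
    simp only [conjLoop]
    rw [← map_mul, hz, map_mul]
  · have h1 := (((continuous_gconj (cxUnit r)).tendsto (toC A)).comp
      (hA.comp (tendsto_twist_cobounded (n := n) r))).const_smul (((r : ℝ) : ℂ) ^ (2 * n))
    rw [toC_smul, toC_gconj, Complex.ofReal_pow]
    refine h1.congr fun z => ?_
    simp only [Function.comp_apply, conjLoop]
    rw [map_smul, map_sub, map_one, smul_smul, ← mul_assoc, pow_mul_twistFactor, one_mul]
  · have hb : (r : ℝ) ^ (2 * n) • beta n ℝ = (r : ℝ) • gconj n r (beta n ℝ) :=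
      (smul_gconj_beta r).symm
    rw [map_add, smul_add, scale_apply, smul_mul_assoc, mul_smul_comm, ← mul_smul_comm,
      ← smul_mul_assoc, hb, mul_smul_comm, smul_mul_assoc, ← smul_sub, ← map_mul, ← map_mul,
      ← map_sub]

/-! ### Simple elements. -/

lemma conjLoop_simpleLoop (r : ℝˣ) (α₁ α₂ : ℝ) (P : Mat n ℝ) :
    conjLoop r (simpleLoop (((r : ℝ) ^ (2 * n))⁻¹ * α₁) (((r : ℝ) ^ (2 * n))⁻¹ * α₂) P) =
      simpleLoop α₁ α₂ (gconj n r P) := by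
  have hc : (((r : ℝ) ^ (2 * n))⁻¹ : ℝ) = (((r ^ (2 * n))⁻¹ : ℝˣ) : ℝ) := by simp
  have h : ∀ a b z : ℂ, (twistFactor n r * b - twistFactor n r * a) /
      (twistFactor n r * z - twistFactor n r * b) = (b - a) / (z - b) := fun a b z => by
    rw [← mul_sub, ← mul_sub, mul_div_mul_left _ _ (twistFactor_ne_zero r)]
  funext z
  simp only [conjLoop, simpleLoop, hc, Complex.ofReal_mul]
  rw [map_add, map_add, map_one, map_smul, map_smul, ← toC_gconj, ← toC_gconj, sharp_gconj]
  congr 2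
  · congr 1
    exact h _ _ _
  · exact h _ _ _

lemma sharp_sharp (P : Mat n ℝ) : sharp (sharp P) = P := by
  simp only [sharp, Matrix.transpose_mul, Matrix.transpose_transpose, rho_transpose]
  simp only [← mul_assoc, rho_mul_rho, one_mul]
  rw [mul_assoc, rho_mul_rho, mul_one]

lemma rho_toC : rho n ℂ = toC (rho n ℝ) := by
  ext a c
  simp only [rho, toC, Matrix.map_apply, Matrix.of_apply]
  split_ifs <;> simp

lemma rho_transpose_toC (P : Mat n ℝ) :
    rho n ℂ * (toC P).transpose * rho n ℂ = toC (sharp P) := by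
  rw [rho_toC, sharp, toC_mul, toC_mul]
  rfl

lemma isRationalLoop_simpleLoop (α₁ α₂ : ℝ) {P : Mat n ℝ} (hP : P * P = P)
    (hiso : IsIsotropic P) : IsRationalLoop n (simpleLoop α₁ α₂ P) := by
  have hz : ∀ a : ℂ, ∀ᶠ z : ℂ in cofinite, z - a ≠ 0 := fun a => by
    filter_upwards [(Set.finite_singleton a).compl_mem_cofinite] with z hz h0
    exact hz (sub_eq_zero.1 h0)
  have hQ : sharp P * sharp P = sharp P := by
    have := congrArg sharp hP
    conv_rhs => rw [← this]
    simp only [sharp, Matrix.transpose_mul]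
    simp only [mul_assoc]
    rw [← mul_assoc (rho n ℝ) (rho n ℝ), rho_mul_rho, one_mul]
  refine ⟨?_, ?_, ?_, ?_⟩
  · let X : Polynomial ℂ := Polynomial.X
    let C : ℂ → Polynomial ℂ := Polynomial.C
    refine ⟨(X - C α₁) * (X - C α₂), Matrix.of fun a c =>
      (X - C α₁) * (X - C α₂) * C ((1 : Mat n ℂ) a c) +
        (X - C α₁) * C (((α₂ : ℂ) - α₁) * toC P a c) +
        (X - C α₂) * C (((α₁ : ℂ) - α₂) * toC (sharp P) a c),
      mul_ne_zero (Polynomial.X_sub_C_ne_zero _) (Polynomial.X_sub_C_ne_zero _), fun z hz => ?_⟩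
    simp only [X, C, Polynomial.eval_mul, Polynomial.eval_sub, Polynomial.eval_X,
      Polynomial.eval_C] at hz
    have h1 := left_ne_zero_of_mul hz
    have h2 := right_ne_zero_of_mul hz
    ext a c
    simp only [simpleLoop, X, C, Matrix.add_apply, Matrix.smul_apply, Matrix.map_apply,
      Matrix.of_apply, Polynomial.eval_mul, Polynomial.eval_sub, Polynomial.eval_add,
      Polynomial.eval_X, Polynomial.eval_C, smul_eq_mul]
    field_simp
  · have hlim : ∀ k a : ℂ, Tendsto (fun z => k / (z - a)) (Bornology.cobounded ℂ) (𝓝 0) := by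
      intro k a
      have h1 : Tendsto (fun z : ℂ => z - a) (Bornology.cobounded ℂ) (Bornology.cobounded ℂ) := by
        simp [sub_eq_add_neg]
      simpa [div_eq_mul_inv] using
        (tendsto_inv₀_cobounded.comp h1).const_mul k
    have h1 := ((hlim (α₂ - α₁) α₂).smul_const (toC P)).const_add (1 : Mat n ℂ)
    have h2 := h1.add ((hlim (α₁ - α₂) α₁).smul_const (toC (sharp P)))
    rw [zero_smul, zero_smul, add_zero, add_zero] at h2
    exact h2
  · filter_upwards [hz α₁, hz α₂] with z h1 h2
    rw [orth_iff]
    set u : ℂ := ((α₂ : ℂ) - α₁) / (z - α₂) with hu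
    set w : ℂ := ((α₁ : ℂ) - α₂) / (z - α₁) with hw
    -- That is `(1 + u)(1 + w) = 1`: on the ranges of `P` and `P^♯` the loop acts by `(z - α₁)/(z -
    -- α₂)` and its inverse.
    have huw : u + w + u * w = 0 := by
      rw [hu, hw]; field_simp; ring
    have e1 : simpleLoop α₁ α₂ P z = 1 + u • toC P + w • toC (sharp P) := rfl
    have e2 : rho n ℂ * (simpleLoop α₁ α₂ P z).transpose * rho n ℂ =
        1 + u • toC (sharp P) + w • toC P := by
      rw [e1, Matrix.transpose_add, Matrix.transpose_add, Matrix.transpose_one,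
        Matrix.transpose_smul, Matrix.transpose_smul, mul_add, mul_add, add_mul, add_mul, mul_one,
        rho_mul_rho, mul_smul_comm, smul_mul_assoc, mul_smul_comm, smul_mul_assoc,
        rho_transpose_toC, rho_transpose_toC, sharp_sharp]
    have p1 : toC P * toC P = toC P := by rw [← toC_mul, hP]
    have p2 : toC (sharp P) * toC (sharp P) = toC (sharp P) := by rw [← toC_mul, hQ]
    have p3 : toC P * toC (sharp P) = 0 := by rw [← toC_mul, hiso.1, toC_zero]
    have p4 : toC (sharp P) * toC P = 0 := by rw [← toC_mul, hiso.2, toC_zero]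
    rw [e2, e1]
    simp only [add_mul, mul_add, one_mul, mul_one, smul_mul_assoc, mul_smul_comm, p1, p2, p3, p4,
      smul_zero, add_zero]
    have h3 : (u + w + u * w) • toC P + (u + w + u * w) • toC (sharp P) = 0 := by
      rw [huw, zero_smul, zero_smul, add_zero]
    refine Eq.trans ?_ (congrArg (1 + ·) h3 |>.trans (add_zero 1))
    module
  · refine Eventually.of_forall fun z => ?_
    ext a c
    have h1 : ∀ a c, (starRingEnd ℂ) ((1 : Mat n ℂ) a c) = (1 : Mat n ℂ) a c := fun a c => by
      rw [Matrix.one_apply]; split_ifs <;> simp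
    simp [simpleLoop, toC, h1]

/-- The expansion at infinity of a simple loop. -/
lemma tendsto_smul_simpleLoop_sub_one (α₁ α₂ : ℝ) (P : Mat n ℝ) :
    Tendsto (fun z => z • (simpleLoop α₁ α₂ P z - 1)) (Bornology.cobounded ℂ)
      (𝓝 (toC ((α₂ - α₁) • P + (α₁ - α₂) • sharp P))) := by
  have hlim : ∀ k a : ℂ, Tendsto (fun z => z * (k / (z - a))) (Bornology.cobounded ℂ) (𝓝 k) := by
    intro k a
    have h1 : Tendsto (fun z : ℂ => z - a) (Bornology.cobounded ℂ) (Bornology.cobounded ℂ) := by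
      simp [sub_eq_add_neg]
    have h2 := ((tendsto_inv₀_cobounded.comp h1).const_mul (k * a)).const_add k
    rw [mul_zero, add_zero] at h2
    refine h2.congr' ?_
    have h3 : ∀ᶠ z : ℂ in Bornology.cobounded ℂ, z ≠ a :=
      Bornology.le_cofinite ℂ ((Set.finite_singleton a).compl_mem_cofinite)
    filter_upwards [h3] with z hz
    have := sub_ne_zero.2 hz
    simp only [Function.comp_apply]
    field_simp
    ring
  have h := ((hlim (α₂ - α₁) α₂).smul_const (toC P)).add
    ((hlim (α₁ - α₂) α₁).smul_const (toC (sharp P)))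
  rw [toC_add, toC_smul, toC_smul, Complex.ofReal_sub, Complex.ofReal_sub]
  refine h.congr fun z => ?_
  rw [simpleLoop, add_assoc, add_sub_cancel_left, smul_add, smul_smul, smul_smul]

/-- `f • q` is defined at the origin. -/
lemma zero_mem_dressDomain_simpleLoop {j : ℕ} (α₁ α₂ : ℝ) {P : Mat n ℝ} (hP : P * P = P)
    (hiso : IsIsotropic P) {q : ℝ → ℝ → Mat n ℝ} (hq : IsFlowSolution n j q)
    {F : ℝ → ℝ → ℂ → Mat n ℂ} (hF : IsFrame n j q F) (hF0 : ∀ z, F 0 0 z = 1) :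
    (0, 0) ∈ dressDomain n j (simpleLoop α₁ α₂ P) q := by
  have hf := isRationalLoop_simpleLoop α₁ α₂ hP hiso
  refine ⟨_, hf, hq, F, hF, hF0, F 0 0, _, _, hF.entire 0 0, hf, ?_,
    tendsto_smul_simpleLoop_sub_one α₁ α₂ P, rfl⟩
  exact Eventually.of_forall fun z => by simp only [hF0, mul_one, one_mul]

/-! ### Transfer of domains and values. -/

/-- The converse is the same covariance applied with `r⁻¹`, since the twists by `r` and `r⁻¹` are
inverse to each other. -/
lemma isDressedValue_scale_iff {j : ℕ} {f : ℂ → Mat n ℂ} {q : ℝ → ℝ → Mat n ℝ} (r : ℝˣ)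
    {x t : ℝ} {v : Mat n ℝ} :
    IsDressedValue n j (conjLoop r f) (scale n j r q) (↑r⁻¹ * x) (↑r⁻¹ ^ (2 * j - 1) * t)
      ((r : ℝ) • gconj n r v) ↔ IsDressedValue n j f q x t v := by
  constructor
  · intro h
    have := h.scale r⁻¹
    rwa [conjLoop_inv_conjLoop, scale_inv_scale, map_smul, gconj_inv_gconj, smul_smul,
      Units.inv_mul, one_smul] at this
  · intro h
    refine IsDressedValue.scale r ?_
    rwa [← mul_assoc, ← mul_assoc, ← mul_pow, Units.mul_inv, one_pow, one_mul, one_mul]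

lemma mem_dressDomain_scale_iff {j : ℕ} {f : ℂ → Mat n ℂ} {q : ℝ → ℝ → Mat n ℝ} (r : ℝˣ)
    {x t : ℝ} : (↑r⁻¹ * x, ↑r⁻¹ ^ (2 * j - 1) * t) ∈
      dressDomain n j (conjLoop r f) (scale n j r q) ↔ (x, t) ∈ dressDomain n j f q := by
  constructor
  · rintro ⟨v, hv⟩
    refine ⟨(↑r⁻¹ : ℝ) • gconj n r⁻¹ v, (isDressedValue_scale_iff r).1 ?_⟩
    rwa [map_smul, gconj_gconj_inv, smul_smul, Units.mul_inv, one_smul]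
  · rintro ⟨v, hv⟩
    exact ⟨_, (isDressedValue_scale_iff r).2 hv⟩

lemma IsDressedValue.dress_eq {j : ℕ} (hn : 1 ≤ n) {f : ℂ → Mat n ℂ} {q : ℝ → ℝ → Mat n ℝ}
    {x t : ℝ} {v : Mat n ℝ} (h : IsDressedValue n j f q x t v) : dress n j f q x t = v := by
  have hex : ∃ v, IsDressedValue n j f q x t v := ⟨v, h⟩
  rw [dress, dif_pos hex]
  exact hex.choose_spec.unique hn h

lemma dress_of_notMem {j : ℕ} {f : ℂ → Mat n ℂ} {q : ℝ → ℝ → Mat n ℝ} {x t : ℝ}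
    (h : (x, t) ∉ dressDomain n j f q) : dress n j f q x t = 0 :=
  dif_neg h

theorem dress_eq_scale_dress {j : ℕ} (hn : 1 ≤ n) (f : ℂ → Mat n ℂ) (q : ℝ → ℝ → Mat n ℝ)
    (r : ℝˣ) :
    dress n j f q = scale n j (↑r⁻¹ : ℝ) (dress n j (conjLoop r f) (scale n j r q)) := by
  funext x t
  rw [scale_apply]
  by_cases h : (x, t) ∈ dressDomain n j f q
  · obtain ⟨v, hv⟩ := h
    rw [((isDressedValue_scale_iff r).2 hv).dress_eq hn, IsDressedValue.dress_eq hn hv, map_smul,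
      gconj_inv_gconj, smul_smul, Units.inv_mul, one_smul]
  -- Off the domain both sides take the default value 0, which scaling fixes.
  · have h' := mt (mem_dressDomain_scale_iff r).1 h
    rw [dress_of_notMem h, dress_of_notMem h', map_zero, smul_zero]

end
end BnFlow

end

theorem mainTheorem9 (n j : ℕ) (hn : 1 ≤ n) (hj : 1 ≤ j)
    (q : ℝ → ℝ → BnFlow.Mat n ℝ) (hq : BnFlow.IsFlowSolution n j q)
    (F : ℝ → ℝ → ℂ → BnFlow.Mat n ℂ) (hF : BnFlow.IsFrame n j q F) (hF0 : ∀ z, F 0 0 z = 1)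
    (r : ℝ) (hr : r ≠ 0) (α : ℝ)
    (P : BnFlow.Mat n ℝ) (V₁ V₂ : Submodule ℝ (Fin (2 * n + 1) → ℝ))
    (hP : BnFlow.IsProjectionOnto P V₁ V₂) (hrank : P.rank = 1) (hiso : BnFlow.IsIsotropic P)
    (P' : BnFlow.Mat n ℝ) (hP' : P' = BnFlow.Gam n r * P * (BnFlow.Gam n r)⁻¹)
    (g g' : ℂ → BnFlow.Mat n ℂ) (hg : g = BnFlow.simpleLoop 1 α P)
    (hg' : g' = BnFlow.simpleLoop ((r ^ (2 * n))⁻¹) ((r ^ (2 * n))⁻¹ * α) P') :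
    -- the conjugated projection is the rank one projection onto `Γ(r) V₁` along `Γ(r) V₂`
    BnFlow.IsProjectionOnto P' (V₁.map (Matrix.toLin' (BnFlow.Gam n r)))
        (V₂.map (Matrix.toLin' (BnFlow.Gam n r))) ∧
      P'.rank = 1 ∧ BnFlow.IsIsotropic P' ∧
      -- both sides are defined at the origin, and they are defined at the same points
      (0, 0) ∈ BnFlow.dressDomain n j g' q ∧
      (0, 0) ∈ BnFlow.dressDomain n j g (BnFlow.scale n j r q) ∧
      (∀ x t : ℝ, (x, t) ∈ BnFlow.dressDomain n j g' q ↔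
        (r⁻¹ * x, r⁻¹ ^ (2 * j - 1) * t) ∈ BnFlow.dressDomain n j g (BnFlow.scale n j r q)) ∧
      -- both sides agree
      BnFlow.dress n j g' q
        = BnFlow.scale n j r⁻¹ (BnFlow.dress n j g (BnFlow.scale n j r q)) := by
  lift r to ℝˣ using hr.isUnit
  rw [← Units.val_inv_eq_inv_val]
  have hproj := BnFlow.isProjectionOnto_Gam_conj r hP
  have hrk := BnFlow.rank_Gam_conj r P
  have hPP := BnFlow.Gam_mul_mul_inv r P
  have hiso' := BnFlow.isIsotropic_gconj r⁻¹ hiso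
  rw [← hP'] at hproj hrk hPP
  rw [← hPP] at hiso'
  -- The pole `1` of `g` comes from `r^{-2n}` under the twist, and `Γ(r)⁻¹ P' Γ(r) = P`; the rest is
  -- covariance for `g'`.
  have hgg : g = BnFlow.conjLoop r g' := by
    have h := BnFlow.conjLoop_simpleLoop r 1 α P'
    rw [mul_one, hPP, BnFlow.gconj_gconj_inv] at h
    rw [hg, hg', ← h, hPP]
  have h0 : (0, 0) ∈ BnFlow.dressDomain n j g' q :=
    hg' ▸ BnFlow.zero_mem_dressDomain_simpleLoop _ _ hproj.1 hiso' hq hF hF0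
  have hdom : ∀ x t : ℝ, (x, t) ∈ BnFlow.dressDomain n j g' q ↔
      ((↑r⁻¹ : ℝ) * x, (↑r⁻¹ : ℝ) ^ (2 * j - 1) * t) ∈
        BnFlow.dressDomain n j g (BnFlow.scale n j r q) := fun x t => by
    rw [hgg]
    exact (BnFlow.mem_dressDomain_scale_iff r).symm
  refine ⟨hproj, hrk.trans hrank, hiso', h0, ?_, hdom, ?_⟩
  · simpa only [mul_zero] using (hdom 0 0).1 h0
  · rw [hgg]
    exact BnFlow.dress_eq_scale_dress hn g' q r
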